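/- Let $R$ be a commutative ring. All categories are small, and gradings are by $\mathbb Z$. **$A_\infty$-categories.** A (non unital) $A_\infty$-category $\mathscr A$ over $R$ is a graded $R$-linear quiver with $R$-multilinear operations $m^n:\mathrm{Hom}(x_{n-1},x_n)\otimes\cdots\otimes\mathrm{Hom}(x_0,x_1)\to\mathrm{Hom}(x_0,x_n)[2-n]$, $n\ge 1$, such that for all homogeneous composable $f_1,\dots,f_n$ $$\sum_{m=1}^{n}\sum_{d=0}^{n-m}(-1)^{\dagger_d}\,m^{n-m+1}\big(f_n,\dots,f_{d+m+1},m^m(f_{d+m},\dots,f_{d+1}),f_d,\dots,f_1\big)=0,\qquad \dagger_d=\deg f_1+\dots+\deg f_d-d.$$ In particular each $(\mathrm{Hom}_{\mathscr A}(x,y),m^1)$ is a DG $R$-module; $|\mathscr A|$ denotes the DG quiver $(\mathscr A,m^1)$. $\mathscr A$ is strictly unital if every object $x$ has an $m^1$-closed $1_x\in\mathrm{Hom}(x,x)$ of degree $0$ with $m^2(f,1_x)=f$ and $m^2(1_x,g)=(-1)^{\deg g}g$ for all homogeneous $f:x\to y$, $g:z\to x$, and $m^n(\dots,1_x,\dots)=0$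 for $n>2$. **Free $A_\infty$-categories.** For a DG quiver $\mathcal Q$, the free non unital $A_\infty$-category $F(\mathcal Q)$ has the objects of $\mathcal Q$ and $$\mathrm{Hom}_{F(\mathcal Q)}(x,y)=\bigoplus_{n\ge1}\ \bigoplus_{t,\;x=x_1,\dots,x_{n+1}=y}\mathrm{Hom}_{\mathcal Q}(x_1,x_2)\otimes\cdots\otimes\mathrm{Hom}_{\mathcal Q}(x_n,x_{n+1}),$$ where $t$ runs over the planar rooted trees with $n$ leaves whose internal vertices all have at least two inputs. For $n\ge2$ the operation $m^n$ is grafting of trees, and $m^1$ is the unique operation which extends $d_{\mathcal Q}$ and makes $F(\mathcal Q)$ an $A_\infty$-category. For $f$ in $\mathcal Q$, $(\bullet;f)$ denotes the corresponding element of the summand of the one-leaf tree. **Semi-free $A_\infty$-categories.** A strictly unital $A_\infty$-category $\mathscr A$ is semi-free if there are $A_\infty$-subcategories $\mathscr A_n$ and DG subquivers $\mathcal Q_n$ of $|\mathscr A|$, all with the objects of $\mathscr A$, $$|\mathscr A_0|\subset\mathcal Q_1\subset|\mathscr A_1|\subset\mathcal Q_2\subset|\mathscr A_2|\subset\cdots\subset|\mathscr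 A|,\qquad \mathscr A=\bigcup_n\mathscr A_n,$$ such that 1. $\mathscr A_0$ is the discrete category: $\mathrm{Hom}_{\mathscr A_0}(x,x)=R\cdot 1_x$ with $R\to R\cdot1_x$, $r\mapsto r1_x$, an isomorphism, and $\mathrm{Hom}_{\mathscr A_0}(x,y)=0$ for $x\ne y$; 2. for every $n>0$, $\mathcal Q_n=|\mathscr A_{n-1}|\oplus\mathscr B_n$ as graded quivers, for some graded quiver $\mathscr B_n$; 3. for every $n>0$, the strict $A_\infty$-functor $F(\mathcal Q_n)\to\mathscr A$ extending the inclusion of $\mathcal Q_n$ induces an isomorphism $F(\mathcal Q_n)/I_n\cong\mathscr A_n$, where $I_n$ is the ideal generated by the elements $(\bullet;m^k_{\mathscr A_{n-1}}(f_k,\dots,f_1))-m^k_{F(\mathcal Q_n)}((\bullet;f_k),\dots,(\bullet;f_1))$, for $k\ge2$ and $f_i$ in $\mathscr A_{n-1}$, together with the relations saying that the elements $(\bullet;1_x)$ are strict units; 4. for every $n>0$, the quotient DG quiver $\mathcal Q_n/|\mathscr A_{n-1}|$ has zero differential, and its hom-spaces are free $R$-modules. **Theorem.** Every semi-free $A_\infty$-category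 $\mathscr A$ has cofibrant morphisms: for all objects $x,y$ of $\mathscr A$, the DG $R$-module $(\mathrm{Hom}_{\mathscr A}(x,y),m^1)$ is a cofibrant object of the projective model structure on unbounded DG $R$-modules (weak equivalences are the quasi-isomorphisms, fibrations are the degreewise surjective maps); that is, $0\to\mathrm{Hom}_{\mathscr A}(x,y)$ has the left lifting property with respect to all degreewise surjective quasi-isomorphisms. -/

import Mathlib

open CategoryTheory

universe u

noncomputable section

namespace AInf

/-! ## Composable strings -/

/-- Composable strings `f₁, …, fₙ` (`n ≥ 0`, `fᵢ : xᵢ₋₁ → xᵢ`) of arrows of a quiver.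
The arrow that is applied first stands first, so that the string `f₁, …, fₙ` is the argument
of the operation usually written `mⁿ(fₙ, …, f₁)`. -/
inductive Str {O : Type u} (H : O → O → Type u) : O → O → Type u
  | nil (x : O) : Str H x x
  | cons {x y z : O} (f : H x y) (s : Str H y z) : Str H x z

namespace Str

variable {O : Type u} {H K : O → O → Type u}

/-- The number of arrows. -/
def length : ∀ {x y : O}, Str H x y → ℕ
  | _, _, nil _ => 0
  | _, _, cons _ s => s.length + 1

/-- Concatenation. -/
def append : ∀ {x y z : O}, Str H x y → Str H y z → Str H x z
  | _, _, _, nil _, t => t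
  | _, _, _, cons f s, t => cons f (s.append t)

/-- Apply a map of quivers (identity on objects) to every arrow. -/
def map (φ : ∀ x y, H x y → K x y) : ∀ {x y : O}, Str H x y → Str K x y
  | _, _, nil x => nil x
  | _, _, cons f s => cons (φ _ _ f) (s.map φ)

/-- The sum of a weight over all arrows. -/
def weight (w : ∀ x y, H x y → ℤ) : ∀ {x y : O}, Str H x y → ℤ
  | _, _, nil _ => 0
  | _, _, cons f s => w _ _ f + s.weight w

/-- A property holds for all arrows. -/
def All (P : ∀ x y, H x y → Prop) : ∀ {x y : O}, Str H x y → Prop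
  | _, _, nil _ => True
  | _, _, cons f s => P _ _ f ∧ s.All P

/-- All ways of writing a string as a concatenation `p ++ q`. -/
def splits : ∀ {x y : O}, Str H x y → List (Σ z : O, Str H x z × Str H z y)
  | _, _, nil x => [⟨x, nil x, nil x⟩]
  | _, _, cons f s =>
      ⟨_, nil _, cons f s⟩ :: s.splits.map fun a => ⟨a.1, cons f a.2.1, a.2.2⟩

end Str

/-! ## `A∞`-categories -/

/-- Homogeneous elements (with their degree) of a graded quiver. -/
abbrev Homog {R : Type u} [CommRing R] {O : Type u} {H : O → O → Type u}
    [∀ x y, AddCommGroup (H x y)] [∀ x y, Module R (H x y)]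
    (gr : ∀ x y, ℤ → Submodule R (H x y)) (x y : O) : Type u :=
  Σ i : ℤ, gr x y i

/-- A (small, non unital) `R`-linear `A∞`-category: a graded `R`-linear quiver with `R`-multilinear
operations `mⁿ` (`n ≥ 1`) of degree `2 - n` that satisfy
`∑ (-1)^{†_d} m^{n-m+1}(fₙ, …, m^m(f_{d+m}, …, f_{d+1}), f_d, …, f₁) = 0`,
where `†_d = deg f_d + ⋯ + deg f₁ - d`.
All the `mⁿ` are bundled into one map on composable strings, with the convention `m⁰ = 0`
(so the terms of the relation with empty inner string vanish). -/
structure AInfCat (R : Type u) [CommRing R] where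
  Ob : Type u
  Hom : Ob → Ob → Type u
  [addCommGroup : ∀ x y, AddCommGroup (Hom x y)]
  [module : ∀ x y, Module R (Hom x y)]
  /-- the homogeneous components of the hom-spaces -/
  gr : ∀ x y, ℤ → Submodule R (Hom x y)
  gr_internal : ∀ x y, DirectSum.IsInternal (gr x y)
  m : ∀ {x y : Ob}, Str Hom x y → Hom x y
  m_nil : ∀ x, m (Str.nil x) = 0
  m_add : ∀ {x y z w : Ob} (p : Str Hom x y) (f g : Hom y z) (q : Str Hom z w),
    m (p.append (.cons (f + g) q)) = m (p.append (.cons f q)) + m (p.append (.cons g q))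
  m_smul : ∀ {x y z w : Ob} (p : Str Hom x y) (r : R) (f : Hom y z) (q : Str Hom z w),
    m (p.append (.cons (r • f) q)) = r • m (p.append (.cons f q))
  /-- `mⁿ` has degree `2 - n`, that is, `deg mⁿ(fₙ, …, f₁) = ∑ (deg fᵢ - 1) + 2`. -/
  m_mem : ∀ {x y : Ob} (s : Str (Homog gr) x y),
    m (s.map fun _ _ f => (f.2 : Hom _ _)) ∈ gr x y (s.weight (fun _ _ f => f.1 - 1) + 2)
  m_rel : ∀ {x y : Ob} (s : Str (Homog gr) x y),
    (s.splits.map fun a => (a.2.2.splits.map fun b =>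
      Int.negOnePow (a.2.1.weight fun _ _ f => f.1 - 1) •
        m ((a.2.1.map fun _ _ f => (f.2 : Hom _ _)).append
          (.cons (m (b.2.1.map fun _ _ f => (f.2 : Hom _ _)))
            (b.2.2.map fun _ _ f => (f.2 : Hom _ _))))).sum).sum = 0

attribute [instance] AInfCat.addCommGroup AInfCat.module

namespace AInfCat

variable {R : Type u} [CommRing R] (A : AInfCat R)

/-- The differential `m¹` of `Hom(x, y)`. -/
def m₁ (x y : A.Ob) : A.Hom x y →ₗ[R] A.Hom x y where
  toFun f := A.m (.cons f (.nil y))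
  map_add' f g := A.m_add (.nil x) f g (.nil y)
  map_smul' r f := A.m_smul (.nil x) r f (.nil y)

theorem m₁_mem {x y : A.Ob} {i : ℤ} {f : A.Hom x y} (hf : f ∈ A.gr x y i) :
    A.m₁ x y f ∈ A.gr x y (i + 1) := by
  have h := A.m_mem (.cons (⟨i, f, hf⟩ : Homog A.gr x y) (.nil y))
  have e : i - 1 + 0 + 2 = i + 1 := by ring
  simp only [Str.weight, e] at h
  exact h

theorem m_zero {x y z w : A.Ob} (p : Str A.Hom x y) (q : Str A.Hom z w) :
    A.m (p.append (.cons (0 : A.Hom y z) q)) = 0 := by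
  simpa using A.m_smul p 0 (0 : A.Hom y z) q

theorem m₁_m₁ {x y : A.Ob} {i : ℤ} {f : A.Hom x y} (hf : f ∈ A.gr x y i) :
    A.m₁ x y (A.m₁ x y f) = 0 := by
  have h := A.m_rel (.cons (⟨i, f, hf⟩ : Homog A.gr x y) (.nil y))
  have h1 := A.m_zero (.nil x) (Str.cons f (.nil y)) (z := x)
  have h2 := A.m_zero (Str.cons f (.nil y)) (.nil y) (z := y)
  simp only [Str.append] at h1 h2
  simp [Str.splits, Str.map, Str.weight, Str.append, A.m_nil, h1, h2] at h
  exact h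

/-- The DG `R`-module `(Hom(x, y), m¹)`, as a cochain complex of `R`-modules. -/
def homComplex (x y : A.Ob) : CochainComplex (ModuleCat.{u} R) ℤ :=
  CochainComplex.of (fun i => ModuleCat.of R (A.gr x y i))
    (fun i => ModuleCat.ofHom
      ((A.m₁ x y).restrict (p := A.gr x y i) (q := A.gr x y (i + 1)) fun _ hf => A.m₁_mem hf))
    (fun _ => by
      ext f
      exact A.m₁_m₁ f.2)

/-- `e` is a family of strict units. The sign in `left` is the one that the sign rule of the
`A∞`-relations forces (the product `g · f = (-1)^{deg f} m²(g, f)` is then unital). -/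
structure IsStrictUnit (e : ∀ x, A.Hom x x) : Prop where
  mem : ∀ x, e x ∈ A.gr x x 0
  closed : ∀ x, A.m₁ x x (e x) = 0
  /-- `m²(f, 1) = f` -/
  right : ∀ {x y} (f : A.Hom x y), A.m (.cons (e x) (.cons f (.nil y))) = f
  /-- `m²(1, f) = (-1)^{deg f} f` -/
  left : ∀ {x y} (i : ℤ) (f : A.Hom x y), f ∈ A.gr x y i →
    A.m (.cons f (.cons (e y) (.nil y))) = Int.negOnePow i • f
  /-- `mⁿ(…, 1, …) = 0` for `n > 2` -/
  higher : ∀ {x y z} (p : Str A.Hom x y) (q : Str A.Hom y z), 2 ≤ p.length + q.length →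
    A.m (p.append (.cons (e y) q)) = 0

/-- A graded subquiver (with the same objects): a family of graded submodules. -/
structure GrSubquiver where
  carrier : ∀ x y, Submodule R (A.Hom x y)
  graded : ∀ x y, carrier x y = ⨆ i, carrier x y ⊓ A.gr x y i

variable {A}

namespace GrSubquiver

variable (Q : A.GrSubquiver)

/-- `Q` is a DG subquiver of the underlying DG quiver. -/
def IsDG : Prop := ∀ x y, ∀ f ∈ Q.carrier x y, A.m₁ x y f ∈ Q.carrier x y

/-- `Q` is an `A∞`-subcategory: it is closed under all the operations. -/
def IsSubcategory : Prop :=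
  ∀ {x y} (s : Str A.Hom x y), s.All (fun x y f => f ∈ Q.carrier x y) → A.m s ∈ Q.carrier x y

/-- Homogeneous elements of `Q`, with their degree. -/
abbrev Elt (x y : A.Ob) : Type u := Σ i : ℤ, ↥(Q.carrier x y ⊓ A.gr x y i)

end GrSubquiver

end AInfCat

/-! ## The free `A∞`-category -/

/-- Planar rooted trees whose leaves are labelled by composable arrows of `L`; all internal
vertices have at least two inputs. `node t₁ t₂ s` is the grafting `t₁ ∨ t₂ ∨ ⋯`, and `leaf f` is
the trivial tree `(•; f)`. -/
inductive PTree {O : Type u} (L : O → O → Type u) : O → O → Type u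
  | leaf {x y : O} (f : L x y) : PTree L x y
  | node {x y z w : O} (t₁ : PTree L x y) (t₂ : PTree L y z) (s : Str (PTree L) z w) : PTree L x w

namespace PTree

variable {O : Type u} {L : O → O → Type u}

mutual
  /-- The degree of a labelled tree: grafting `n` trees is an operation of degree `2 - n`. -/
  def deg (d : ∀ x y, L x y → ℤ) : ∀ {x y : O}, PTree L x y → ℤ
    | _, _, leaf f => d _ _ f
    | _, _, node t₁ t₂ s => (t₁.deg d - 1) + (t₂.deg d - 1) + strDeg d s + 2
  /-- The sum of the shifted degrees of a string of labelled trees. -/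
  def strDeg (d : ∀ x y, L x y → ℤ) : ∀ {x y : O}, Str (PTree L) x y → ℤ
    | _, _, .nil _ => 0
    | _, _, .cons t s => (t.deg d - 1) + strDeg d s
end

/-- The grafting `t₁ ∨ ⋯ ∨ tₙ` of a string of `n ≥ 2` trees, as an element of the free `R`-module
on labelled trees; shorter strings are not grafted and are sent to `0`. -/
def graft (R : Type u) [CommRing R] : ∀ {x y : O}, Str (PTree L) x y → (PTree L x y →₀ R)
  | _, _, .cons t₁ (.cons t₂ s) => Finsupp.single (node t₁ t₂ s) 1
  | _, _, .cons _ (.nil _) => 0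
  | _, _, .nil _ => 0

/-- The linear map `t ↦ p₁ ∨ ⋯ ∨ pₖ ∨ t ∨ q₁ ∨ ⋯ ∨ qₗ`, that is,
`t ↦ m^{k+1+l}(qₗ, …, q₁, t, pₖ, …, p₁)`; it is zero if `k = l = 0`. -/
def insert (R : Type u) [CommRing R] {x y z w : O} (p : Str (PTree L) x y) (q : Str (PTree L) z w) :
    (PTree L y z →₀ R) →ₗ[R] (PTree L x w →₀ R) :=
  Finsupp.linearCombination R fun t => graft R (p.append (.cons t q))

/-- The smallest family of submodules of the free modules on labelled trees which contains `S`
and is stable under grafting (with the element in any position). -/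
inductive Ideal {R : Type u} [CommRing R] (S : ∀ x y, (PTree L x y →₀ R) → Prop) :
    ∀ x y, (PTree L x y →₀ R) → Prop
  | base {x y} (a : PTree L x y →₀ R) : S x y a → Ideal S x y a
  | zero {x y} : Ideal S x y 0
  | add {x y} (a b : PTree L x y →₀ R) : Ideal S x y a → Ideal S x y b → Ideal S x y (a + b)
  | smul {x y} (r : R) (a : PTree L x y →₀ R) : Ideal S x y a → Ideal S x y (r • a)
  | insert {x y z w} (p : Str (PTree L) x y) (q : Str (PTree L) z w) (a : PTree L y z →₀ R) :
      Ideal S y z a → Ideal S x w (PTree.insert R p q a)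

end PTree

namespace AInfCat

variable {R : Type u} [CommRing R] {A : AInfCat R}

namespace GrSubquiver

variable (Q C : A.GrSubquiver) (e : ∀ x, A.Hom x x)

mutual
  /-- The value in `A` of a tree labelled by elements of `Q`: grafting is replaced by `mⁿ`. -/
  def evalTree : ∀ {x y : A.Ob}, PTree Q.Elt x y → A.Hom x y
    | _, _, .leaf f => f.2.1
    | _, _, .node t₁ t₂ s => A.m (.cons (evalTree t₁) (.cons (evalTree t₂) (evalStr s)))
  /-- The values of a string of trees. -/
  def evalStr : ∀ {x y : A.Ob}, Str (PTree Q.Elt) x y → Str A.Hom x y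
    | _, _, .nil x => .nil x
    | _, _, .cons t s => .cons (evalTree t) (evalStr s)
end

/-- The strict functor `F(Q) → A` extending the inclusion of `Q`, on the level of the
free modules on labelled trees. -/
def eval (x y : A.Ob) : (PTree Q.Elt x y →₀ R) →ₗ[R] A.Hom x y :=
  Finsupp.linearCombination R fun t => Q.evalTree t

/-- Linearity in the leaves. The free `R`-module on trees labelled by homogeneous elements of `Q`,
modulo the stable family of submodules generated by these elements, is
`Hom_{F(Q)}(x, y) = ⨁_t Hom_Q(x₁, x₂) ⊗ ⋯ ⊗ Hom_Q(xₙ, xₙ₊₁)`. -/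
inductive LinRel : ∀ x y, (PTree Q.Elt x y →₀ R) → Prop
  | add {x y : A.Ob} (i : ℤ) (f g : ↥(Q.carrier x y ⊓ A.gr x y i)) :
      LinRel x y (.single (.leaf ⟨i, f + g⟩) 1 - .single (.leaf ⟨i, f⟩) 1
        - .single (.leaf ⟨i, g⟩) 1)
  | smul {x y : A.Ob} (i : ℤ) (r : R) (f : ↥(Q.carrier x y ⊓ A.gr x y i)) :
      LinRel x y (.single (.leaf ⟨i, r • f⟩) 1 - r • .single (.leaf ⟨i, f⟩) 1)

/-- The relations `(•; mⁿ(fₙ, …, f₁)) = mⁿ_{F(Q)}((•; fₙ), …, (•; f₁))` for `n ≥ 2` and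
`fᵢ` in the subcategory `C`. -/
inductive SubcatRel : ∀ x y, (PTree Q.Elt x y →₀ R) → Prop
  | mk {x y : A.Ob} (s : Str Q.Elt x y) (g : Q.Elt x y) (hs : 2 ≤ s.length)
      (hC : s.All fun x y f => (f.2 : A.Hom x y) ∈ C.carrier x y)
      (hg : (g.2 : A.Hom x y) = A.m (s.map fun _ _ f => (f.2 : A.Hom _ _))) :
      SubcatRel x y (.single (.leaf g) 1 - PTree.graft R (s.map fun _ _ f => .leaf f))

/-- The relations which make the `(•; eₓ)` strict units. -/
inductive UnitRel : ∀ x y, (PTree Q.Elt x y →₀ R) → Prop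
  | right {x y : A.Ob} (u : Q.Elt x x) (hu : (u.2 : A.Hom x x) = e x) (t : PTree Q.Elt x y) :
      UnitRel x y (PTree.graft R (.cons (.leaf u) (.cons t (.nil y))) - .single t 1)
  | left {x y : A.Ob} (u : Q.Elt y y) (hu : (u.2 : A.Hom y y) = e y) (t : PTree Q.Elt x y) :
      UnitRel x y (PTree.graft R (.cons t (.cons (.leaf u) (.nil y)))
        - Int.negOnePow (t.deg fun _ _ f => f.1) • .single t 1)
  | higher {x y z : A.Ob} (u : Q.Elt y y) (hu : (u.2 : A.Hom y y) = e y)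
      (p : Str (PTree Q.Elt) x y) (q : Str (PTree Q.Elt) y z) (h : 2 ≤ p.length + q.length) :
      UnitRel x z (PTree.graft R (p.append (.cons (.leaf u) q)))

/-- The strict functor `F(Q) → A` extending the inclusion of the DG quiver `Q ⊆ |A|` induces an
isomorphism from `F(Q) / (R_C, units)` onto the subcategory `D` of `A`, where `R_C` are the
relations which make `C → F(Q)` compatible with the operations `mⁿ`.

The operation `m¹` of `F(Q)` is the only one which makes `F(Q)` an `A∞`-category and which extends
the differential of `Q`. As `A` satisfies the `A∞`-relations, every map to `A` that is compatible
with the `mⁿ`, `n ≥ 2`, and on `Q` with `m¹`, is compatible with `m¹`. Likewise, the ideal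
generated by the relations under the `mⁿ`, `n ≥ 2`, is stable under `m¹`. -/
def IsFreeExtension (D : A.GrSubquiver) : Prop :=
  ∀ x y,
    LinearMap.range (Q.eval x y) = D.carrier x y ∧
    ∀ a, Q.eval x y a = 0 ↔
      PTree.Ideal (fun x y a => Q.LinRel x y a ∨ Q.SubcatRel C x y a ∨ Q.UnitRel e x y a) x y a

end GrSubquiver

/-- A sequence `A₀ ⊆ Q₁ ⊆ A₁ ⊆ Q₂ ⊆ ⋯` which exhibits the strictly unital `A∞`-category `A`, with
units `e`, as semi-free over the discrete category. Here `sub n` is `Aₙ` and `quiv n` is `Qₙ₊₁`. -/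
structure SemiFreeFiltration (A : AInfCat R) (e : ∀ x, A.Hom x x) where
  sub : ℕ → A.GrSubquiver
  quiv : ℕ → A.GrSubquiver
  sub_isSubcategory : ∀ n, (sub n).IsSubcategory
  quiv_isDG : ∀ n, (quiv n).IsDG
  sub_le_quiv : ∀ n x y, (sub n).carrier x y ≤ (quiv n).carrier x y
  quiv_le_sub : ∀ n x y, (quiv n).carrier x y ≤ (sub (n + 1)).carrier x y
  exhaustive : ∀ x y (f : A.Hom x y), ∃ n, f ∈ (sub n).carrier x y
  /-- the strictly unital strict functor from the discrete category, `r · 1ₓ ↦ r • eₓ`,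
  is an embedding -/
  unit_injective : ∀ x, Function.Injective fun r : R => r • e x
  /-- its image is `A₀` -/
  sub_zero_self : ∀ x, (sub 0).carrier x x = Submodule.span R {e x}
  sub_zero_ne : ∀ x y, x ≠ y → (sub 0).carrier x y = ⊥
  /-- `Qₙ₊₁ ≃ |Aₙ| + B` as graded quivers -/
  split : ∀ n, ∃ B : A.GrSubquiver, ∀ x y,
    Disjoint ((sub n).carrier x y) (B.carrier x y) ∧
    (sub n).carrier x y ⊔ B.carrier x y = (quiv n).carrier x y
  /-- `Aₙ₊₁` is the free extension of `Aₙ` by the DG quiver `Qₙ₊₁` -/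
  free_extension : ∀ n, (quiv n).IsFreeExtension (sub n) e (sub (n + 1))
  /-- the quotient `Qₙ₊₁ / |Aₙ|` has zero differential -/
  differential_mem : ∀ n x y, ∀ f ∈ (quiv n).carrier x y, A.m₁ x y f ∈ (sub n).carrier x y
  /-- the hom-spaces of `Qₙ₊₁ / |Aₙ|` are free -/
  free_quotient : ∀ n x y, Module.Free R
    (↥((quiv n).carrier x y) ⧸ ((sub n).carrier x y).submoduleOf ((quiv n).carrier x y))

/-- Semi-free (strictly unital) `A∞`-categories. -/
def IsSemiFree (A : AInfCat R) : Prop :=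
  ∃ e : ∀ x, A.Hom x x, A.IsStrictUnit e ∧ Nonempty (A.SemiFreeFiltration e)

end AInfCat

/-! ## The projective model structure on DG `R`-modules -/

/-- Trivial fibrations: degreewise surjective quasi-isomorphisms. -/
def trivialFibrations (R : Type u) [CommRing R] :
    MorphismProperty (CochainComplex (ModuleCat.{u} R) ℤ) :=
  fun _ _ p => (∀ i, Function.Surjective (p.f i)) ∧ QuasiIso p

/-- Cofibrations: the maps with the left lifting property with respect to trivial fibrations. -/
def cofibrations (R : Type u) [CommRing R] :
    MorphismProperty (CochainComplex (ModuleCat.{u} R) ℤ) :=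
  (trivialFibrations R).llp

/-- Cofibrant DG `R`-modules. -/
def IsCofibrant {R : Type u} [CommRing R] (K : CochainComplex (ModuleCat.{u} R) ℤ) : Prop :=
  cofibrations R (Limits.initial.to K)

/-- `A` has cofibrant morphisms. -/
def AInfCat.HasCofibrantMorphisms {R : Type u} [CommRing R] (A : AInfCat R) : Prop :=
  ∀ x y : A.Ob, IsCofibrant (A.homComplex x y)

end AInf

end

-- Each hom-complex is a retract of a complex with a well-ordered `R`-basis whose differential sends
-- every basis element into the span of strictly smaller ones. Such a complex lifts against trivial
-- fibrations by recursion along the basis, and retracts inherit the lifting property.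
--
-- The basis: at every stage `n` lift a basis of the free quotient of `quiv n` by `sub n` to the
-- graded complement and take all homogeneous components. These are the generators. Let `U` be the
-- free module on the units and the planar trees labelled by generators, with the operations of the
-- free strictly unital algebra (`UTree.op`), and let `ev : U → Hom` be `evalLin`. The chosen basis
-- of the quotient need not be homogeneous, so the generators may be linearly dependent and `ev`
-- need not be injective. It does have a linear section `σ` compatible with all `mⁿ`, `n ≥ 2`: the
-- section is obvious on the discrete category, and it extends over each free extension by the
-- universal property (`IsSection.exists_extension`, `exists_isGlobalSection`). From `ev ∘ σ = 1` it
-- follows that `σ ∘ m¹ ∘ ev` is a differential on `U` for which `σ` and `ev` are chain maps.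
--
-- The order: ranks are polynomials in an infinitely large variable `ω`, which are well-ordered. A
-- generator of stage `n` has rank `ω^(n+1)` and a vertex with `k` inputs adds `k - 2`. The
-- differential of a generator of stage `n` lies in `sub n`, whose section involves only powers up
-- to `ω^n`. For a vertex with `k` inputs, the `A∞`-relation writes `m¹(mᵏ(…))` through terms with
-- `m¹` inside, which are smaller by induction, and terms `mⁱ(…, mʲ(…), …)` with `i + j = k + 1` and
-- `i, j ≥ 2`, whose vertices contribute `(i - 2) + (j - 2) = k - 3`. So the rank drops
-- (`IsGlobalSection.m₁_rank_lt`), and the recursion is carried out in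
-- `IsGlobalSection.exists_lift`.

noncomputable section

namespace AInf

/-! ## Strings -/

namespace Str

variable {O : Type u} {H K L : O → O → Type u}

theorem append_nil : ∀ {x y : O} (s : Str H x y), s.append (.nil y) = s
  | _, _, .nil _ => rfl
  | _, _, .cons f s => congrArg (Str.cons f) s.append_nil

theorem append_assoc : ∀ {x y z w : O} (s : Str H x y) (t : Str H y z) (r : Str H z w),
    (s.append t).append r = s.append (t.append r)
  | _, _, _, _, .nil _, _, _ => rfl
  | _, _, _, _, .cons f s, t, r => congrArg (Str.cons f) (s.append_assoc t r)

theorem length_append : ∀ {x y z : O} (s : Str H x y) (t : Str H y z),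
    (s.append t).length = s.length + t.length
  | _, _, _, .nil _, t => by simp [append, length]
  | _, _, _, .cons f s, t => by simp [append, length, length_append s t]; omega

theorem length_map (φ : ∀ x y, H x y → K x y) : ∀ {x y : O} (s : Str H x y),
    (s.map φ).length = s.length
  | _, _, .nil _ => rfl
  | _, _, .cons f s => by simp [map, length, length_map φ s]

theorem map_append (φ : ∀ x y, H x y → K x y) : ∀ {x y z : O} (s : Str H x y) (t : Str H y z),
    (s.append t).map φ = (s.map φ).append (t.map φ)
  | _, _, _, .nil _, _ => rfl
  | _, _, _, .cons _ s, t => congrArg (Str.cons _) (map_append φ s t)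

theorem map_map (φ : ∀ x y, H x y → K x y) (ψ : ∀ x y, K x y → L x y) :
    ∀ {x y : O} (s : Str H x y), (s.map φ).map ψ = s.map fun x y f => ψ x y (φ x y f)
  | _, _, .nil _ => rfl
  | _, _, .cons _ s => congrArg (Str.cons _) (map_map φ ψ s)

theorem map_congr {φ ψ : ∀ x y, H x y → K x y} : ∀ {x y : O} {s : Str H x y},
    s.All (fun x y f => φ x y f = ψ x y f) → s.map φ = s.map ψ
  | _, _, .nil _, _ => rfl
  | _, _, .cons f s, h => by simp only [map]; rw [h.1, map_congr h.2]

theorem all_of_forall {P : ∀ x y, H x y → Prop} (h : ∀ x y f, P x y f) :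
    ∀ {x y : O} (s : Str H x y), s.All P
  | _, _, .nil _ => trivial
  | _, _, .cons _ s => ⟨h _ _ _, all_of_forall h s⟩

theorem all_append {P : ∀ x y, H x y → Prop} : ∀ {x y z : O} {s : Str H x y} {t : Str H y z},
    (s.append t).All P ↔ s.All P ∧ t.All P
  | _, _, _, .nil _, t => by simp [append, All]
  | _, _, _, .cons f s, t => by simp [append, All, all_append, and_assoc]

theorem all_map {φ : ∀ x y, H x y → K x y} {P : ∀ x y, K x y → Prop} :
    ∀ {x y : O} {s : Str H x y}, (s.map φ).All P ↔ s.All fun x y f => P x y (φ x y f)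
  | _, _, .nil _ => Iff.rfl
  | _, _, .cons _ _ => and_congr_right fun _ => all_map

theorem append_eq_of_mem_splits : ∀ {x y : O} {s : Str H x y} {a}, a ∈ s.splits →
    a.2.1.append a.2.2 = s
  | _, _, .nil _, a, h => by
      simp only [splits, List.mem_singleton] at h; subst h; rfl
  | _, _, .cons f s, a, h => by
      simp only [splits, List.mem_cons, List.mem_map] at h
      obtain rfl | ⟨b, hb, rfl⟩ := h
      · rfl
      · exact congrArg (Str.cons f) (append_eq_of_mem_splits hb)

/-- Modulo `N`, a sum over all the splittings `s = p ++ q` reduces to the term with `q` empty if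
the other terms lie in `N`. -/
theorem sum_splits_sub_mem {M : Type*} [AddCommGroup M] (N : AddSubgroup M) :
    ∀ {x y : O} (s : Str H x y) (φ : (Σ z : O, Str H x z × Str H z y) → M),
    (∀ a ∈ s.splits, a.2.2.length ≠ 0 → φ a ∈ N) →
    (s.splits.map φ).sum - φ ⟨y, s, .nil y⟩ ∈ N
  | _, _, .nil _, φ, h => by simp [splits]
  | x, y, .cons f s, φ, h => by
      have h1 := sum_splits_sub_mem N s (fun a => φ ⟨a.1, .cons f a.2.1, a.2.2⟩)
        (fun a ha hl => h _ (by simp only [splits, List.mem_cons, List.mem_map]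
                                exact Or.inr ⟨a, ha, rfl⟩) hl)
      have h2 := h ⟨x, .nil x, .cons f s⟩ (by simp [splits]) (by simp [length])
      simp only [splits, List.map_cons, List.map_map, List.sum_cons]
      have := N.add_mem h2 h1
      rw [add_sub_assoc]
      exact this

/-- Two strings with the same objects whose arrows are related one by one. -/
inductive Forall₂ (r : ∀ x y, H x y → K x y → Prop) :
    ∀ {x y : O}, Str H x y → Str K x y → Prop
  | nil (x : O) : Forall₂ r (.nil x) (.nil x)
  | cons {x y z : O} {f : H x y} {g : K x y} {s : Str H y z} {t : Str K y z} :
      r x y f g → Forall₂ r s t → Forall₂ r (.cons f s) (.cons g t)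

theorem Forall₂.length_eq {r : ∀ x y, H x y → K x y → Prop} {x y : O} {s : Str H x y}
    {t : Str K x y} (h : Forall₂ r s t) : s.length = t.length := by
  induction h with
  | nil => rfl
  | cons _ _ ih => simp [length, ih]

theorem Forall₂.exists_append {r : ∀ x y, H x y → K x y → Prop} :
    ∀ {x y z : O} {s : Str H x z} {t₁ : Str K x y} {t₂ : Str K y z},
    Forall₂ r s (t₁.append t₂) →
    ∃ (s₁ : Str H x y) (s₂ : Str H y z), s = s₁.append s₂ ∧ Forall₂ r s₁ t₁ ∧ Forall₂ r s₂ t₂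
  | _, _, _, s, .nil _, t₂, h => ⟨.nil _, s, rfl, .nil _, h⟩
  | _, _, _, s, .cons g t₁, t₂, h => by
      cases h with
      | cons h1 h2 =>
        obtain ⟨s₁, s₂, rfl, h3, h4⟩ := h2.exists_append
        exact ⟨.cons _ s₁, s₂, rfl, .cons h1 h3, h4⟩

section Linear

variable {R : Type u} [CommRing R]

/-- A property of strings which is stable under linear combinations in each position holds if it
holds for strings of generators. -/
theorem span_induction [∀ x y, AddCommGroup (H x y)] [∀ x y, Module R (H x y)]
    (G : ∀ x y, Set (H x y)) (hG : ∀ x y, Submodule.span R (G x y) = ⊤)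
    {P : ∀ {x y : O}, Str H x y → Prop}
    (gen : ∀ {x y : O} (s : Str H x y), s.All (fun x y f => f ∈ G x y) → P s)
    (zero : ∀ {x y z w : O} (p : Str H x y) (q : Str H z w), P (p.append (.cons (0 : H y z) q)))
    (hadd : ∀ {x y z w : O} (p : Str H x y) (f g : H y z) (q : Str H z w),
      P (p.append (.cons f q)) → P (p.append (.cons g q)) → P (p.append (.cons (f + g) q)))
    (smul : ∀ {x y z w : O} (p : Str H x y) (r : R) (f : H y z) (q : Str H z w),
      P (p.append (.cons f q)) → P (p.append (.cons (r • f) q)))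
    {x y : O} (s : Str H x y) : P s := by
  -- The prefix `p` already consists of generators; the induction moves arrows from the arbitrary
  -- suffix `q` into it, one at a time.
  suffices h : ∀ {y z : O} (q : Str H y z) {x : O} (p : Str H x y),
      p.All (fun x y f => f ∈ G x y) → P (p.append q) from h s (.nil _) trivial
  intro y z q
  induction q with
  | nil y => intro x p hp; rw [append_nil]; exact gen p hp
  | @cons y z w f q ih =>
    intro x p hp
    have hf : f ∈ Submodule.span R (G y z) := hG y z ▸ Submodule.mem_top
    induction hf using Submodule.span_induction with
    | mem f hf =>
      have := ih (p.append (.cons f (.nil _))) (all_append.2 ⟨hp, hf, trivial⟩)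
      rwa [append_assoc] at this
    | zero => exact zero p q
    | add f g _ _ h1 h2 => exact hadd p f g q h1 h2
    | smul r f _ h => exact smul p r f q h

variable {M : Type*} [AddCommGroup M] [Module R M]

/-- Formal linear combinations of parallel arrows. -/
abbrev _root_.AInf.Lin (R : Type u) [CommRing R] (H : O → O → Type u) (x y : O) : Type u :=
  H x y →₀ R

/-- The multilinear extension to strings of formal linear combinations. -/
def extend : ∀ {x y : O}, Str (Lin R H) x y → (Str H x y → M) → M
  | _, _, .nil x, Φ => Φ (.nil x)
  | _, _, .cons v s, Φ =>
      Finsupp.linearCombination R (fun b => extend s fun t => Φ (.cons b t)) v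

theorem extend_add : ∀ {x y z w : O} (Φ : Str H x w → M) (p : Str (Lin R H) x y)
    (f g : H y z →₀ R) (q : Str (Lin R H) z w),
    extend (p.append (.cons (f + g) q)) Φ =
      extend (p.append (.cons f q)) Φ + extend (p.append (.cons g q)) Φ
  | _, _, _, _, Φ, .nil _, f, g, q => by simp [append, extend]
  | _, _, _, _, Φ, .cons v p, f, g, q => by
      simp only [append, extend, extend_add _ p f g q, Finsupp.linearCombination_apply,
        smul_add, Finsupp.sum_add]

theorem extend_smul : ∀ {x y z w : O} (Φ : Str H x w → M) (p : Str (Lin R H) x y)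
    (r : R) (f : H y z →₀ R) (q : Str (Lin R H) z w),
    extend (p.append (.cons (r • f) q)) Φ = r • extend (p.append (.cons f q)) Φ
  | _, _, _, _, Φ, .nil _, r, f, q => by simp [append, extend]
  | _, _, _, _, Φ, .cons v p, r, f, q => by
      simp only [append, extend, extend_smul _ p r f q, Finsupp.linearCombination_apply,
        Finsupp.smul_sum, smul_comm r]

theorem extend_zero {x y z w : O} (Φ : Str H x w → M) (p : Str (Lin R H) x y)
    (q : Str (Lin R H) z w) :
    extend (p.append (.cons (0 : H y z →₀ R) q)) Φ = 0 := by
  simpa using extend_smul Φ p (0 : R) 0 q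

theorem extend_single : ∀ {x y : O} (Φ : Str H x y → M) (s : Str H x y),
    extend (s.map fun x y b => (Finsupp.single b 1 : Lin R H x y)) Φ = Φ s
  | _, _, Φ, .nil _ => rfl
  | _, _, Φ, .cons b s => by simp [map, extend, extend_single _ s]

/-- All bounds on degree and rank of `UTree.op` come from this: by multilinearity only strings of
basis elements taken from the supports contribute. -/
theorem extend_mem {N : Submodule R M} : ∀ {x y : O} {Φ : Str H x y → M}
    {v : Str (Lin R H) x y},
    (∀ u, Forall₂ (fun _ _ b f => b ∈ f.support) u v → Φ u ∈ N) → extend v Φ ∈ N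
  | _, _, Φ, .nil _, h => h _ (.nil _)
  | _, _, Φ, .cons f v, h => by
      simp only [extend, Finsupp.linearCombination_apply]
      exact N.sum_mem fun b hb => N.smul_mem _ (extend_mem fun u hu => h _ (.cons hb hu))

theorem extend_eq_zero {x y : O} {Φ : Str H x y → M} {v : Str (Lin R H) x y}
    (h : ∀ u, Forall₂ (fun _ _ b f => b ∈ f.support) u v → Φ u = 0) : extend v Φ = 0 := by
  have := extend_mem (N := (⊥ : Submodule R M)) (Φ := Φ) (v := v) (by simpa using h)
  simpa using this

end Linear

end Str

/-! ## Trees -/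

namespace PTree

variable {O : Type u} {L : O → O → Type u}

/-- Structural induction for planar trees. -/
theorem induction {P : ∀ x y, PTree L x y → Prop}
    (leaf : ∀ {x y : O} (f : L x y), P x y (.leaf f))
    (node : ∀ {x y z w : O} (t₁ : PTree L x y) (t₂ : PTree L y z) (s : Str (PTree L) z w),
      P _ _ t₁ → P _ _ t₂ → s.All P → P _ _ (.node t₁ t₂ s)) {x y : O} (t : PTree L x y) :
    P x y t :=
  PTree.rec (motive_1 := P) (motive_2 := fun _ _ s => s.All P)
    (fun f => leaf f) (fun t₁ t₂ s h₁ h₂ h => node t₁ t₂ s h₁ h₂ h)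
    (fun _ => trivial) (fun _ _ h hs => ⟨h, hs⟩) t

section Fold

variable {V : O → O → Type u} (op : ∀ {x y : O}, Str V x y → V x y) (ψ : ∀ x y, L x y → V x y)

mutual
  /-- The value of a tree when the leaves are replaced by their images under `ψ` and grafting is
  replaced by `op`. -/
  def fold : ∀ {x y : O}, PTree L x y → V x y
    | _, _, .leaf f => ψ _ _ f
    | _, _, .node t₁ t₂ s => op (.cons (fold t₁) (.cons (fold t₂) (foldStr s)))
  /-- The values of a string of trees. -/
  def foldStr : ∀ {x y : O}, Str (PTree L) x y → Str V x y
    | _, _, .nil x => .nil x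
    | _, _, .cons t s => .cons (fold t) (foldStr s)
end

theorem foldStr_eq_map : ∀ {x y : O} (s : Str (PTree L) x y),
    foldStr op ψ s = s.map fun _ _ t => fold op ψ t
  | _, _, .nil _ => by simp [foldStr, Str.map]
  | _, _, .cons t s => by simp [foldStr, Str.map, foldStr_eq_map s]

theorem fold_leaf {x y : O} (f : L x y) : fold op ψ (.leaf f) = ψ x y f := by simp [fold]

theorem fold_node {x y z w : O} (t₁ : PTree L x y) (t₂ : PTree L y z) (s : Str (PTree L) z w) :
    fold op ψ (.node t₁ t₂ s) =
      op ((Str.cons t₁ (.cons t₂ s)).map fun _ _ t => fold op ψ t) := by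
  simp [fold, foldStr_eq_map, Str.map]

end Fold

theorem strDeg_eq_weight (d : ∀ x y, L x y → ℤ) : ∀ {x y : O} (s : Str (PTree L) x y),
    strDeg d s = s.weight fun _ _ t => t.deg d - 1
  | _, _, .nil _ => by simp [strDeg, Str.weight]
  | _, _, .cons t s => by simp [strDeg, Str.weight, strDeg_eq_weight d s]

theorem deg_leaf (d : ∀ x y, L x y → ℤ) {x y : O} (f : L x y) : (leaf f).deg d = d x y f := by
  simp [deg]

theorem deg_node (d : ∀ x y, L x y → ℤ) {x y z w : O} (t₁ : PTree L x y) (t₂ : PTree L y z)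
    (s : Str (PTree L) z w) :
    (node t₁ t₂ s).deg d = ((Str.cons t₁ (.cons t₂ s)).weight fun _ _ t => t.deg d - 1) + 2 := by
  simp [deg, Str.weight, strDeg_eq_weight, add_assoc]

theorem graft_of_length_lt (R : Type u) [CommRing R] {x y : O} {s : Str (PTree L) x y}
    (h : s.length < 2) : graft R s = 0 := by
  match s, h with
  | .nil _, _ => rfl
  | .cons _ (.nil _), _ => rfl
  | .cons _ (.cons _ s), h => simp [Str.length] at h

end PTree

/-! ## Ranks -/

/-- Polynomials with natural coefficients in an infinitely large variable. -/
abbrev Rank : Type := Colex (ℕ →₀ ℕ)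

namespace Rank

/-- The `n`-th power of the variable. -/
def pow (n : ℕ) : Rank := toColex (Finsupp.single n 1)

/-- The polynomials of degree at most `n`. -/
def lowDegree (n : ℕ) : AddSubmonoid Rank where
  carrier := {γ | ∀ k, n < k → ofColex γ k = 0}
  zero_mem' := fun _ _ => rfl
  add_mem' := fun {a b} ha hb k hk => by
    have : ofColex (a + b) k = ofColex a k + ofColex b k := rfl
    rw [this, ha k hk, hb k hk]

theorem pow_mem_lowDegree {k n : ℕ} (h : k ≤ n) : pow k ∈ lowDegree n := fun l hl =>
  Finsupp.single_eq_of_ne (by omega)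

theorem lowDegree_mono {k n : ℕ} (h : k ≤ n) : lowDegree k ≤ lowDegree n :=
  fun _ hγ l hl => hγ l (h.trans_lt hl)

/-- The reason for using powers: a tree of any size whose generators have stages below `n` ranks
below a single generator of stage `n`. -/
theorem lt_pow_of_mem_lowDegree {n : ℕ} {γ : Rank} (h : γ ∈ lowDegree n) : γ < pow (n + 1) := by
  rw [Finsupp.Colex.lt_iff]
  refine ⟨n + 1, fun j hj => ?_, ?_⟩
  · rw [h j (by omega)]
    exact (Finsupp.single_eq_of_ne (by omega)).symm
  · rw [h (n + 1) (by omega)]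
    simp [pow]

theorem pow_pos (n : ℕ) : 0 < pow n := by
  rw [Finsupp.Colex.lt_iff]
  exact ⟨n, fun j hj => (Finsupp.single_eq_of_ne (by omega)).symm, by simp [pow]⟩

/-- The colexicographic order compares the highest power first, so a smaller polynomial cannot
contain a power that exceeds all those of the larger one. -/
theorem mem_lowDegree_of_le {n : ℕ} {γ δ : Rank} (h : γ ≤ δ) (hδ : δ ∈ lowDegree n) :
    γ ∈ lowDegree n := by
  obtain rfl | h := h.eq_or_lt
  · exact hδ
  obtain ⟨j, hj, hlt⟩ := Finsupp.Colex.lt_iff.1 h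
  intro k hk
  rcases lt_trichotomy j k with h1 | rfl | h1
  · rw [hj k h1]; exact hδ k hk
  · rw [hδ _ hk] at hlt; simp at hlt
  · rw [hδ j (by omega)] at hlt; simp at hlt

end Rank

namespace Str

variable {O : Type u} {H K : O → O → Type u} {M : Type*} [AddCommMonoid M]

/-- The sum over all the arrows. -/
def total (w : ∀ x y, H x y → M) : ∀ {x y : O}, Str H x y → M
  | _, _, .nil _ => 0
  | _, _, .cons f s => w _ _ f + s.total w

theorem total_append (w : ∀ x y, H x y → M) : ∀ {x y z : O} (s : Str H x y) (t : Str H y z),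
    (s.append t).total w = s.total w + t.total w
  | _, _, _, .nil _, t => by simp [append, total]
  | _, _, _, .cons f s, t => by simp [append, total, total_append w s t, add_assoc]

theorem total_map (w : ∀ x y, K x y → M) (φ : ∀ x y, H x y → K x y) :
    ∀ {x y : O} (s : Str H x y), (s.map φ).total w = s.total fun x y f => w x y (φ x y f)
  | _, _, .nil _ => rfl
  | _, _, .cons _ s => congrArg (_ + ·) (total_map w φ s)

end Str

namespace PTree

variable {O : Type u} {L : O → O → Type u}

mutual
  /-- The rank of a tree whose leaves have stages: a leaf of stage `n` counts as the
  `(n + 1)`-st power, and a vertex with `k` inputs as `k - 2`. -/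
  def rank (st : ∀ x y, L x y → ℕ) : ∀ {x y : O}, PTree L x y → Rank
    | _, _, .leaf f => Rank.pow (st _ _ f + 1)
    | _, _, .node t₁ t₂ s => rank st t₁ + (rank st t₂ + strRank st s) + s.length • Rank.pow 0
  /-- The sum of the ranks of a string of trees. -/
  def strRank (st : ∀ x y, L x y → ℕ) : ∀ {x y : O}, Str (PTree L) x y → Rank
    | _, _, .nil _ => 0
    | _, _, .cons t s => rank st t + strRank st s
end

theorem strRank_eq_total (st : ∀ x y, L x y → ℕ) : ∀ {x y : O} (s : Str (PTree L) x y),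
    strRank st s = s.total fun _ _ t => t.rank st
  | _, _, .nil _ => by simp [strRank, Str.total]
  | _, _, .cons t s => by simp [strRank, Str.total, strRank_eq_total st s]

theorem rank_leaf (st : ∀ x y, L x y → ℕ) {x y : O} (f : L x y) :
    (leaf f).rank st = Rank.pow (st x y f + 1) := by simp [rank]

theorem rank_node (st : ∀ x y, L x y → ℕ) {x y z w : O} (t₁ : PTree L x y) (t₂ : PTree L y z)
    (s : Str (PTree L) z w) :
    (node t₁ t₂ s).rank st = ((Str.cons t₁ (.cons t₂ s)).total fun _ _ t => t.rank st)
      + s.length • Rank.pow 0 := by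
  simp [rank, Str.total, strRank_eq_total]

end PTree

/-! ## The free strictly unital algebra over the operations `mⁿ`, `n ≥ 2` -/

/-- Labelled planar trees and units. -/
inductive UTree {O : Type u} (L : O → O → Type u) : O → O → Type u
  | unit (x : O) : UTree L x x
  | tree {x y : O} (t : PTree L x y) : UTree L x y

namespace UTree

variable {O : Type u} {L : O → O → Type u}

/-- The degree. -/
def deg (d : ∀ x y, L x y → ℤ) : ∀ {x y : O}, UTree L x y → ℤ
  | _, _, unit _ => 0
  | _, _, tree t => t.deg d

/-- The rank. -/
def rank (st : ∀ x y, L x y → ℕ) : ∀ {x y : O}, UTree L x y → Rank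
  | _, _, unit _ => 0
  | _, _, tree t => t.rank st

theorem deg_unit (d : ∀ x y, L x y → ℤ) (x : O) : (unit x : UTree L x x).deg d = 0 := rfl

theorem rank_unit (st : ∀ x y, L x y → ℕ) (x : O) : (unit x : UTree L x x).rank st = 0 := rfl

/-- The elements other than the units. -/
def IsTree : ∀ {x y : O}, UTree L x y → Prop
  | _, _, unit _ => False
  | _, _, tree _ => True

/-- The underlying string of trees, if there is no unit. -/
def toTrees : ∀ {x y : O}, Str (UTree L) x y → Option (Str (PTree L) x y)
  | _, _, .nil x => some (.nil x)
  | _, _, .cons (.unit _) _ => none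
  | _, _, .cons (.tree t) s => (toTrees s).map (.cons t)

theorem toTrees_map : ∀ {x y : O} (s : Str (PTree L) x y),
    toTrees (s.map fun _ _ t => tree t) = some s
  | _, _, .nil _ => rfl
  | _, _, .cons t s => by simp [Str.map, toTrees, toTrees_map s]

theorem eq_map_of_toTrees : ∀ {x y : O} {s : Str (UTree L) x y} {s' : Str (PTree L) x y},
    toTrees s = some s' → s = s'.map fun _ _ t => tree t
  | _, _, .nil _, s', h => by
      simp only [toTrees, Option.some.injEq] at h; subst h; rfl
  | _, _, .cons (.unit _) s, s', h => by simp [toTrees] at h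
  | _, _, .cons (.tree t) s, s', h => by
      simp only [toTrees, Option.map_eq_some_iff] at h
      obtain ⟨a, ha, rfl⟩ := h
      rw [eq_map_of_toTrees ha]; rfl

theorem toTrees_append_unit : ∀ {x y z : O} (p : Str (UTree L) x y) (q : Str (UTree L) y z),
    toTrees (p.append (.cons (unit y) q)) = none
  | _, _, _, .nil _, q => rfl
  | _, _, _, .cons (.unit _) p, q => rfl
  | _, _, _, .cons (.tree t) p, q => by simp [Str.append, toTrees, toTrees_append_unit p q]

theorem exists_eq_map : ∀ {x y : O} {s : Str (UTree L) x y}, s.All (fun _ _ u => u.IsTree) →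
    ∃ s' : Str (PTree L) x y, s = s'.map fun _ _ t => tree t
  | _, _, .nil x, _ => ⟨.nil x, rfl⟩
  | _, _, .cons (.unit _) s, h => h.1.elim
  | _, _, .cons (.tree t) s, h => by
      obtain ⟨s', rfl⟩ := exists_eq_map h.2
      exact ⟨.cons t s', rfl⟩

variable (R : Type u) [CommRing R] (d : ∀ x y, L x y → ℤ)

/-- The operations on basis elements; they are zero on strings of length less than two. -/
def basisOp : ∀ {x y : O}, Str (UTree L) x y → Lin R (UTree L) x y
  | _, _, .nil _ => 0
  | _, _, .cons _ (.nil _) => 0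
  | _, _, .cons (.unit _) (.cons f (.nil _)) => Finsupp.single f 1
  | _, _, .cons (.unit _) (.cons _ (.cons _ _)) => 0
  | _, _, .cons (.tree t) (.cons (.unit _) (.nil _)) =>
      Int.negOnePow (t.deg d) • Finsupp.single (.tree t) 1
  | _, _, .cons (.tree _) (.cons (.unit _) (.cons _ _)) => 0
  | _, _, .cons (.tree t₁) (.cons (.tree t₂) s) =>
      match toTrees s with
      | some s' => Finsupp.single (.tree (.node t₁ t₂ s')) 1
      | none => 0

/-- The cases of the definition of `basisOp`. -/
theorem basisOp_cases {P : ∀ x y, Str (UTree L) x y → Lin R (UTree L) x y → Prop}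
    (zero : ∀ {x y : O} (s : Str (UTree L) x y), P x y s 0)
    (unit_left : ∀ {x y : O} (f : UTree L x y),
      P x y (.cons (unit x) (.cons f (.nil y))) (Finsupp.single f 1))
    (unit_right : ∀ {x y : O} (f : UTree L x y), P x y (.cons f (.cons (unit y) (.nil y)))
      (Int.negOnePow (f.deg d) • Finsupp.single f 1))
    (node : ∀ {x y z w : O} (t₁ : PTree L x y) (t₂ : PTree L y z) (s : Str (PTree L) z w),
      P x w ((Str.cons t₁ (.cons t₂ s)).map fun _ _ t => tree t)
        (Finsupp.single (tree (.node t₁ t₂ s)) 1)) :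
    ∀ {x y : O} (s : Str (UTree L) x y), P x y s (basisOp R d s)
  | _, _, .nil _ => zero _
  | _, _, .cons _ (.nil _) => by unfold basisOp; exact zero _
  | _, _, .cons (.unit _) (.cons f (.nil _)) => unit_left f
  | _, _, .cons (.unit _) (.cons _ (.cons _ _)) => zero _
  | _, _, .cons (.tree t) (.cons (.unit _) (.nil _)) => unit_right (.tree t)
  | _, _, .cons (.tree _) (.cons (.unit _) (.cons _ _)) => zero _
  | _, _, .cons (.tree t₁) (.cons (.tree t₂) s) => by
      cases h : toTrees s with
      | none => simp only [basisOp, h]; exact zero _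
      | some s' =>
        simp only [basisOp, h]
        rw [eq_map_of_toTrees h]
        exact node t₁ t₂ s'

theorem basisOp_of_length_lt {x y : O} {s : Str (UTree L) x y} (h : s.length < 2) :
    basisOp R d s = 0 := by
  match s, h with
  | .nil _, _ => rfl
  | .cons _ (.nil _), _ => unfold basisOp; rfl
  | .cons _ (.cons _ s), h => simp [Str.length] at h

theorem basisOp_unit_left {x y : O} (f : UTree L x y) :
    basisOp R d (.cons (unit x) (.cons f (.nil y))) = Finsupp.single f 1 := rfl

theorem basisOp_unit_right {x y : O} (f : UTree L x y) :
    basisOp R d (.cons f (.cons (unit y) (.nil y))) =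
      Int.negOnePow (f.deg d) • Finsupp.single f 1 := by
  cases f with
  | unit => simp [basisOp, deg]
  | tree t => rfl

theorem basisOp_unit_higher {x y z : O} (p : Str (UTree L) x y) (q : Str (UTree L) y z)
    (h : 2 ≤ p.length + q.length) : basisOp R d (p.append (.cons (unit y) q)) = 0 := by
  match p, q, h with
  | .nil _, .nil _, h => simp [Str.length] at h
  | .nil _, .cons _ (.nil _), h => simp [Str.length] at h
  | .nil _, .cons _ (.cons _ _), h => rfl
  | .cons _ (.nil _), .nil _, h => simp [Str.length] at h
  | .cons (.unit _) (.nil _), .cons _ _, h => rfl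
  | .cons (.tree _) (.nil _), .cons _ _, h => rfl
  | .cons (.unit _) (.cons _ (.nil _)), q, h => rfl
  | .cons (.unit _) (.cons _ (.cons _ _)), q, h => rfl
  | .cons (.tree _) (.cons (.unit _) (.nil _)), q, h => rfl
  | .cons (.tree _) (.cons (.unit _) (.cons _ _)), q, h => rfl
  | .cons (.tree t₁) (.cons (.tree t₂) p), q, h =>
      simp only [Str.append, basisOp, toTrees_append_unit]

theorem basisOp_tree {x y z w : O} (t₁ : PTree L x y) (t₂ : PTree L y z) (s : Str (PTree L) z w) :
    basisOp R d ((Str.cons t₁ (.cons t₂ s)).map fun _ _ t => tree t) =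
      Finsupp.single (tree (.node t₁ t₂ s)) 1 := by
  simp only [Str.map, basisOp, toTrees_map]

/-- The operations. -/
def op {x y : O} (s : Str (Lin R (UTree L)) x y) : Lin R (UTree L) x y := s.extend (basisOp R d)

variable {R}

/-- There is no `m¹` on `U`. Since `graft` also kills strings of length less than two,
`treeLin_graft` holds for all strings. -/
theorem op_of_length_lt {x y : O} {s : Str (Lin R (UTree L)) x y} (h : s.length < 2) :
    op R d s = 0 :=
  Str.extend_eq_zero fun _ hu => basisOp_of_length_lt R d (hu.length_eq ▸ h)

theorem op_unit_left {x y : O} (f : Lin R (UTree L) x y) :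
    op R d (.cons (Finsupp.single (unit x) 1) (.cons f (.nil y))) = f := by
  simp only [op, Str.extend, Finsupp.linearCombination_single, one_smul, basisOp_unit_left]
  simp only [Finsupp.linearCombination_apply, Finsupp.smul_single, smul_eq_mul, mul_one]
  exact Finsupp.sum_single f

/-- The sign depends on the degree, so homogeneity of `f` is needed. This is why strict sections are
required to preserve degrees. -/
theorem op_unit_right {x y : O} {i : ℤ} {f : Lin R (UTree L) x y}
    (hf : f ∈ Finsupp.supported R R {u | u.deg d = i}) :
    op R d (.cons f (.cons (Finsupp.single (unit y) 1) (.nil y))) = Int.negOnePow i • f := by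
  simp only [op, Str.extend, Finsupp.linearCombination_single, one_smul, basisOp_unit_right]
  rw [Finsupp.linearCombination_apply]
  conv_rhs => rw [← Finsupp.sum_single f]
  rw [Finsupp.sum, Finsupp.sum, Finset.smul_sum]
  refine Finset.sum_congr rfl fun u hu => ?_
  have : u.deg d = i := hf hu
  rw [this, smul_comm, Finsupp.smul_single, smul_eq_mul, mul_one]

theorem op_unit_higher {x y z : O} (p : Str (Lin R (UTree L)) x y) (q : Str (Lin R (UTree L)) y z)
    (h : 2 ≤ p.length + q.length) :
    op R d (p.append (.cons (Finsupp.single (unit y) 1) q)) = 0 := by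
  refine Str.extend_eq_zero fun u hu => ?_
  obtain ⟨p', q', rfl, hp, hq⟩ := hu.exists_append
  cases hq with
  | cons h1 h2 =>
    have := Finsupp.support_single_subset h1
    rw [Finset.mem_singleton] at this
    subst this
    exact basisOp_unit_higher R d _ _ (by rw [hp.length_eq, h2.length_eq]; exact h)

theorem op_single {x y : O} (s : Str (UTree L) x y) :
    op R d (s.map fun _ _ u => Finsupp.single u 1) = basisOp R d s :=
  Str.extend_single _ _

section Bounds

variable {H : O → O → Type u} {φ : ∀ x y, H x y → Lin R (UTree L) x y}

theorem forall₂_of_support {Q : ∀ x y, H x y → Set (UTree L x y)} {x y : O} {s : Str H x y}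
    {u : Str (UTree L) x y}
    (hs : s.All fun x y f => φ x y f ∈ Finsupp.supported R R (Q x y f))
    (hu : Str.Forall₂ (fun _ _ b f => b ∈ f.support) u (s.map φ)) :
    Str.Forall₂ (fun x y b f => b ∈ Q x y f) u s := by
  induction s with
  | nil => cases hu; exact .nil _
  | cons f s ih =>
    cases hu with
    | cons h1 h2 => exact .cons (hs.1 h1) (ih hs.2 h2)

theorem op_mem_deg {d' : ∀ x y, H x y → ℤ} {x y : O} {s : Str H x y}
    (hs : s.All fun x y f => φ x y f ∈ Finsupp.supported R R {u | u.deg d = d' x y f}) :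
    op R d (s.map φ) ∈
      Finsupp.supported R R {u | u.deg d = (s.weight fun x y f => d' x y f - 1) + 2} := by
  refine Str.extend_mem fun u hu => ?_
  have h : (u.weight fun _ _ f => f.deg d - 1) = s.weight fun x y f => d' x y f - 1 := by
    have := forall₂_of_support hs hu
    clear hu hs
    induction this with
    | nil => rfl
    | cons h1 _ ih => simp only [Str.weight, ih]; rw [h1]
  rw [← h]
  refine basisOp_cases (P := fun x y u f => f ∈ Finsupp.supported R R
    {v | v.deg d = (u.weight fun _ _ f => f.deg d - 1) + 2}) R d ?_ ?_ ?_ ?_ u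
  · exact fun _ => Submodule.zero_mem _
  · intro x y f
    refine Finsupp.single_mem_supported R _ ?_
    simp [Str.weight, deg_unit]; ring
  · intro x y f
    rw [Units.smul_def]
    refine zsmul_mem (Finsupp.single_mem_supported R _ ?_) _
    simp [Str.weight, deg_unit]; ring
  · intro x y z w t₁ t₂ s
    refine Finsupp.single_mem_supported R _ ?_
    have : ∀ {x y : O} (s : Str (PTree L) x y), ((s.map fun _ _ t => tree t).weight
        fun _ _ f => f.deg d - 1) = s.weight fun _ _ t => t.deg d - 1 := by
      intro x y s
      induction s with
      | nil => rfl
      | cons t s ih => simp only [Str.map, Str.weight, ih]; rfl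
    rw [Set.mem_ofPred_eq, this]
    exact PTree.deg_node d t₁ t₂ s

variable (st : ∀ x y, L x y → ℕ)

/-- For a grafting this is an equality, by the choice of the weight `k - 2`. For a product with a
unit, the unit has rank `0` and the weight of a binary vertex is `0` as well. -/
theorem basisOp_mem_rank {x y : O} (u : Str (UTree L) x y) :
    basisOp R d u ∈ Finsupp.supported R R
      {v | v.rank st ≤ u.total (fun _ _ f => f.rank st) + (u.length - 2) • Rank.pow 0} := by
  refine basisOp_cases (P := fun x y u f => f ∈ Finsupp.supported R R
    {v | v.rank st ≤ u.total (fun _ _ f => f.rank st) + (u.length - 2) • Rank.pow 0}) R d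
    ?_ ?_ ?_ ?_ u
  · exact fun _ => Submodule.zero_mem _
  · intro x y f
    refine Finsupp.single_mem_supported R _ ?_
    simp [Str.total, rank_unit, Str.length]
  · intro x y f
    rw [Units.smul_def]
    refine zsmul_mem (Finsupp.single_mem_supported R _ ?_) _
    simp [Str.total, rank_unit, Str.length]
  · intro x y z w t₁ t₂ s
    refine Finsupp.single_mem_supported R _ ?_
    rw [Set.mem_ofPred_eq, Str.total_map, Str.length_map]
    exact (PTree.rank_node st t₁ t₂ s).le

theorem op_mem_lowDegree {n : ℕ} {x y : O} {s : Str H x y}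
    (hs : s.All fun x y f => φ x y f ∈ Finsupp.supported R R {u | u.rank st ∈ Rank.lowDegree n}) :
    op R d (s.map φ) ∈ Finsupp.supported R R {u | u.rank st ∈ Rank.lowDegree n} := by
  refine Str.extend_mem fun u hu => ?_
  have h : u.total (fun _ _ f => f.rank st) ∈ Rank.lowDegree n := by
    have := forall₂_of_support hs hu
    clear hu hs
    induction this with
    | nil => exact zero_mem _
    | cons h1 _ ih => exact add_mem h1 ih
  exact fun v hv => Rank.mem_lowDegree_of_le (basisOp_mem_rank d st u hv)
    (add_mem h (nsmul_mem (Rank.pow_mem_lowDegree (Nat.zero_le _)) _))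

variable {r : ∀ x y, H x y → Rank}

theorem total_rank_le {x y : O} {s : Str H x y} {u : Str (UTree L) x y}
    (h : Str.Forall₂ (fun x y b f => b ∈ {u : UTree L x y | u.rank st ≤ r x y f}) u s) :
    u.total (fun _ _ f => f.rank st) ≤ s.total r := by
  induction h with
  | nil => exact le_rfl
  | cons h1 _ ih => exact add_le_add h1 ih

theorem op_mem_rank_le {x y : O} {s : Str H x y} (hs : s.All fun x y f =>
      φ x y f ∈ Finsupp.supported R R {u | u.rank st ≤ r x y f}) :
    op R d (s.map φ) ∈ Finsupp.supported R R
      {u | u.rank st ≤ s.total r + (s.length - 2) • Rank.pow 0} := by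
  refine Str.extend_mem fun u hu => ?_
  have hl : u.length = s.length := by rw [hu.length_eq, Str.length_map]
  replace hu := forall₂_of_support hs hu
  have h1 := total_rank_le st hu
  have h3 := basisOp_mem_rank (R := R) d st u
  rw [hl] at h3
  exact fun v hv => le_trans (h3 hv) (add_le_add_left h1 _)

/-- Addition of ranks is strictly monotone, so a strict bound in one slot gives a strict bound for
the result. -/
theorem op_mem_rank_lt {x y z w : O} {p : Str H x y} {q : Str H z w} {g : Lin R (UTree L) y z}
    {δ : Rank}
    (hp : p.All fun x y f => φ x y f ∈ Finsupp.supported R R {u | u.rank st ≤ r x y f})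
    (hg : g ∈ Finsupp.supported R R {u | u.rank st < δ})
    (hq : q.All fun x y f => φ x y f ∈ Finsupp.supported R R {u | u.rank st ≤ r x y f}) :
    op R d ((p.map φ).append (.cons g (q.map φ))) ∈ Finsupp.supported R R {u | u.rank st <
      p.total r + (δ + q.total r) + (p.length + q.length - 1) • Rank.pow 0} := by
  refine Str.extend_mem fun u hu => ?_
  have hl : u.length - 2 = p.length + q.length - 1 := by
    rw [hu.length_eq]; simp only [Str.length_append, Str.length_map, Str.length]; omega
  obtain ⟨p', q', rfl, hp', hq'⟩ := hu.exists_append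
  cases hq' with
  | @cons _ _ _ b _ q' _ h1 h2 =>
    have h3 := basisOp_mem_rank (R := R) d st (p'.append (.cons b q'))
    rw [hl] at h3
    intro v hv
    have h4 : v.rank st ≤ _ := h3 hv
    change v.rank st < _
    refine h4.trans_lt ?_
    refine add_lt_add_left ?_ _
    rw [Str.total_append]
    exact add_lt_add_of_le_of_lt (total_rank_le st (forall₂_of_support hp hp'))
      (add_lt_add_of_lt_of_le (hg h1) (total_rank_le st (forall₂_of_support hq h2)))

end Bounds

end UTree

-- Homogeneous components and graded subquivers

namespace AInfCat

variable {R : Type u} [CommRing R] (A : AInfCat R)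

/-- The projection to the component of degree `i`. -/
def proj (x y : A.Ob) (i : ℤ) : A.Hom x y →ₗ[R] A.Hom x y :=
  (A.gr x y i).subtype ∘ₗ DirectSum.component R ℤ (fun i => A.gr x y i) i ∘ₗ
    (LinearEquiv.ofBijective (DirectSum.coeLinearMap (A.gr x y)) (A.gr_internal x y)).symm

theorem proj_mem {x y : A.Ob} (i : ℤ) (f : A.Hom x y) : A.proj x y i f ∈ A.gr x y i :=
  Submodule.coe_mem _

theorem proj_of_mem {x y : A.Ob} {i j : ℤ} {f : A.Hom x y} (hf : f ∈ A.gr x y i) :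
    A.proj x y j f = if i = j then f else 0 := by
  have h : (LinearEquiv.ofBijective (DirectSum.coeLinearMap (A.gr x y)) (A.gr_internal x y)).symm f
      = DirectSum.lof R ℤ (fun i => A.gr x y i) i ⟨f, hf⟩ := by
    rw [LinearEquiv.symm_apply_eq]
    exact (DirectSum.coeLinearMap_lof (A.gr x y) i ⟨f, hf⟩).symm
  simp only [proj, LinearMap.comp_apply, LinearEquiv.coe_coe, h]
  split_ifs with hij
  · subst hij
    rw [DirectSum.component.lof_self]; rfl
  · rw [DirectSum.component.of]
    simp [hij]

theorem proj_self {x y : A.Ob} {i : ℤ} {f : A.Hom x y} (hf : f ∈ A.gr x y i) :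
    A.proj x y i f = f := by rw [A.proj_of_mem hf, if_pos rfl]

theorem exists_sum_proj {x y : A.Ob} (f : A.Hom x y) :
    ∃ s : Finset ℤ, f = ∑ i ∈ s, A.proj x y i f := by
  have hf : f ∈ ⨆ i, A.gr x y i := by
    rw [(A.gr_internal x y).submodule_iSup_eq_top]; trivial
  induction hf using Submodule.iSup_induction' with
  | mem i f hf => exact ⟨{i}, by rw [Finset.sum_singleton, A.proj_self hf]⟩
  | zero => exact ⟨∅, rfl⟩
  | add f g _ _ hf hg =>
    classical
    obtain ⟨s, hs⟩ := hf
    obtain ⟨t, ht⟩ := hg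
    refine ⟨s ∪ t, ?_⟩
    have key : ∀ (f : A.Hom x y) (s t : Finset ℤ), s ⊆ t → f = ∑ i ∈ s, A.proj x y i f →
        f = ∑ i ∈ t, A.proj x y i f := by
      intro f s t hst hs
      rw [← Finset.sum_subset hst, ← hs]
      intro j _ hj
      -- Components outside `s` vanish: expand `f` once more by `hs` and use that components of
      -- different degrees are orthogonal.
      conv_lhs => rw [hs]
      rw [map_sum]
      refine Finset.sum_eq_zero fun i hi => ?_
      rw [A.proj_of_mem (A.proj_mem i f), if_neg]
      rintro rfl; exact hj hi
    simp only [map_add, Finset.sum_add_distrib]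
    rw [← key f s _ Finset.subset_union_left hs, ← key g t _ Finset.subset_union_right ht]

variable {A}

theorem GrSubquiver.proj_mem (Q : A.GrSubquiver) {x y : A.Ob} (i : ℤ) {f : A.Hom x y}
    (hf : f ∈ Q.carrier x y) : A.proj x y i f ∈ Q.carrier x y := by
  rw [Q.graded] at hf
  induction hf using Submodule.iSup_induction' with
  | mem j f hf =>
    rw [A.proj_of_mem hf.2]
    split_ifs
    · exact hf.1
    · exact Submodule.zero_mem _
  | zero => simp
  | add f g _ _ hf hg => rw [map_add]; exact Submodule.add_mem _ hf hg

/-- The operations on homogeneous arguments. -/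
theorem m_mem_of_all {H : A.Ob → A.Ob → Type u} {φ : ∀ x y, H x y → A.Hom x y}
    {d : ∀ x y, H x y → ℤ} {x y : A.Ob} {s : Str H x y}
    (hs : s.All fun x y f => φ x y f ∈ A.gr x y (d x y f)) :
    A.m (s.map φ) ∈ A.gr x y ((s.weight fun x y f => d x y f - 1) + 2) := by
  have : ∃ s' : Str (Homog A.gr) x y, (s'.map fun _ _ f => (f.2 : A.Hom _ _)) = s.map φ ∧
      (s'.weight fun _ _ f => f.1 - 1) = s.weight fun x y f => d x y f - 1 := by
    induction s with
    | nil x => exact ⟨.nil x, rfl, rfl⟩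
    | cons f s ih =>
      obtain ⟨s', h1, h2⟩ := ih hs.2
      exact ⟨.cons ⟨_, _, hs.1⟩ s', congrArg _ h1, congrArg (_ + ·) h2⟩
  obtain ⟨s', h1, h2⟩ := this
  rw [← h1, ← h2]
  exact A.m_mem s'

theorem GrSubquiver.evalTree_eq_fold (Q : A.GrSubquiver) {x y : A.Ob} (t : PTree Q.Elt x y) :
    Q.evalTree t = t.fold A.m fun _ _ f => f.2.1 := by
  have hstr : ∀ {x y : A.Ob} (s : Str (PTree Q.Elt) x y),
      Q.evalStr s = s.map fun _ _ t => Q.evalTree t := by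
    intro x y s
    induction s with
    | nil => simp [evalStr, Str.map]
    | cons t s ih => simp [evalStr, Str.map, ih]
  refine PTree.induction (P := fun x y t => Q.evalTree t = t.fold A.m fun _ _ f => f.2.1)
    ?_ ?_ t
  · intro x y f; rw [evalTree, PTree.fold_leaf]
  · intro x y z w t₁ t₂ s h₁ h₂ h
    rw [evalTree, PTree.fold_node, hstr, h₁, h₂, Str.map_congr h]; rfl

-- Generators of a semi-free filtration and evaluation of their trees

namespace SemiFreeFiltration

variable {e : ∀ x, A.Hom x x} (F : A.SemiFreeFiltration e)

theorem sub_mono {n k : ℕ} (h : n ≤ k) (x y : A.Ob) :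
    (F.sub n).carrier x y ≤ (F.sub k).carrier x y := by
  induction k, h using Nat.le_induction with
  | base => exact le_rfl
  | succ k _ ih => exact ih.trans ((F.sub_le_quiv k x y).trans (F.quiv_le_sub k x y))

theorem unit_mem (n : ℕ) (x : A.Ob) : e x ∈ (F.sub n).carrier x x :=
  F.sub_mono (Nat.zero_le n) x x (by rw [F.sub_zero_self]; exact Submodule.mem_span_singleton_self _)

/-- The quotient of the `n`-th quiver by the `n`-th subcategory. -/
abbrev Quot (n : ℕ) (x y : A.Ob) : Type u :=
  ↥((F.quiv n).carrier x y) ⧸ ((F.sub n).carrier x y).submoduleOf ((F.quiv n).carrier x y)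

instance (n : ℕ) (x y : A.Ob) : Module.Free R (F.Quot n x y) := F.free_quotient n x y

/-- A basis of the quotient. -/
def basis (n : ℕ) (x y : A.Ob) : Module.Basis (Module.Free.ChooseBasisIndex R (F.Quot n x y)) R
    (F.Quot n x y) := Module.Free.chooseBasis R _

/-- Labels of the homogeneous components of the elements of the bases of the quotients. -/
structure Label (x y : A.Ob) : Type u where
  /-- the stage at which the generator is adjoined -/
  stage : ℕ
  /-- the element of the basis -/
  index : Module.Free.ChooseBasisIndex R (F.Quot stage x y)
  /-- the degree of the component -/
  degree : ℤ

/-- The stage at which a generator is adjoined. -/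
def stage (x y : A.Ob) (l : F.Label x y) : ℕ := l.stage

/-- The degree of a generator. -/
def labelDeg (x y : A.Ob) (l : F.Label x y) : ℤ := l.degree

/-- A graded complement of the `n`-th subcategory in the `n`-th quiver. -/
def compl (n : ℕ) : A.GrSubquiver := (F.split n).choose

theorem isCompl (n : ℕ) (x y : A.Ob) :
    IsCompl (((F.sub n).carrier x y).submoduleOf ((F.quiv n).carrier x y))
      (((F.compl n).carrier x y).submoduleOf ((F.quiv n).carrier x y)) := by
  obtain ⟨h1, h2⟩ := (F.split n).choose_spec x y
  change Disjoint _ ((F.compl n).carrier x y) at h1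
  change _ ⊔ ((F.compl n).carrier x y) = _ at h2
  constructor
  · rw [Submodule.disjoint_def] at h1 ⊢
    intro f hf hg
    exact Subtype.ext (h1 f.1 hf hg)
  · rw [codisjoint_iff, eq_top_iff]
    rintro ⟨f, hf⟩ -
    have hf' := hf
    rw [← h2, Submodule.mem_sup] at hf'
    obtain ⟨a, ha, b, hb, rfl⟩ := hf'
    have hq : b ∈ (F.quiv n).carrier x y := by rw [← h2]; exact Submodule.mem_sup_right hb
    exact Submodule.mem_sup.2 ⟨⟨a, F.sub_le_quiv n x y ha⟩, ha, ⟨b, hq⟩, hb, rfl⟩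

/-- The projection of the `n`-th quiver to the `n`-th subcategory along the complement. -/
def retr (n : ℕ) (x y : A.Ob) : (F.quiv n).carrier x y →ₗ[R] (F.sub n).carrier x y :=
  (Submodule.submoduleOfEquivOfLe (F.sub_le_quiv n x y)).toLinearMap ∘ₗ
    Submodule.projectionOnto _ _ (F.isCompl n x y)

theorem coe_retr (n : ℕ) {x y : A.Ob} (f : (F.quiv n).carrier x y) :
    (F.retr n x y f : A.Hom x y) =
      (Submodule.projectionOnto _ _ (F.isCompl n x y) f : (F.quiv n).carrier x y) := rfl

theorem retr_of_mem (n : ℕ) {x y : A.Ob} {f : (F.quiv n).carrier x y}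
    (hf : (f : A.Hom x y) ∈ (F.sub n).carrier x y) : F.retr n x y f = ⟨f, hf⟩ := by
  apply Subtype.ext
  rw [coe_retr]
  exact congrArg _ (congrArg _ (Submodule.projectionOnto_apply_left (F.isCompl n x y) ⟨f, hf⟩))

theorem retr_of_mem_compl (n : ℕ) {x y : A.Ob} {f : (F.quiv n).carrier x y}
    (hf : (f : A.Hom x y) ∈ (F.compl n).carrier x y) : F.retr n x y f = 0 := by
  apply Subtype.ext
  rw [coe_retr]
  exact congrArg _ (congrArg _ (Submodule.projectionOnto_apply_right (F.isCompl n x y) ⟨f, hf⟩))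

theorem sub_retr_mem (n : ℕ) {x y : A.Ob} (f : (F.quiv n).carrier x y) :
    (f : A.Hom x y) - F.retr n x y f ∈ (F.compl n).carrier x y :=
  Submodule.sub_projection_mem (F.isCompl n x y) f

theorem compl_le_quiv (n : ℕ) (x y : A.Ob) :
    (F.compl n).carrier x y ≤ (F.quiv n).carrier x y := by
  rw [← ((F.split n).choose_spec x y).2]
  exact le_sup_right

/-- Taking degree-`i` components of `f = retr f + (f - retr f)` gives another decomposition of `f`
along the two graded summands, so uniqueness forces `retr f` to be its own component. -/
theorem retr_mem_gr (n : ℕ) {x y : A.Ob} {i : ℤ} {f : (F.quiv n).carrier x y}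
    (hf : (f : A.Hom x y) ∈ A.gr x y i) : (F.retr n x y f : A.Hom x y) ∈ A.gr x y i := by
  have ha := (F.sub n).proj_mem i (F.retr n x y f).2
  have hb := (F.compl n).proj_mem i (F.sub_retr_mem n f)
  have h : f = (⟨_, F.sub_le_quiv n x y ha⟩ + ⟨_, F.compl_le_quiv n x y hb⟩ :
      (F.quiv n).carrier x y) := by
    apply Subtype.ext
    simp only [Submodule.coe_add, map_sub, A.proj_self hf]
    abel
  rw [h, map_add, F.retr_of_mem_compl n (f := ⟨_, _⟩) hb, F.retr_of_mem n (f := ⟨_, _⟩) ha,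
    add_zero]
  exact A.proj_mem _ _

/-- The section of the quotient map with values in the complement. -/
def lift (n : ℕ) (x y : A.Ob) : F.Quot n x y →ₗ[R] A.Hom x y :=
  Submodule.liftQ _ (((F.quiv n).carrier x y).subtype -
    ((F.sub n).carrier x y).subtype ∘ₗ F.retr n x y) fun f hf => by
      rw [LinearMap.mem_ker, LinearMap.sub_apply, LinearMap.comp_apply,
        F.retr_of_mem n (show (f : A.Hom x y) ∈ _ from hf)]
      exact sub_self _

theorem lift_mk (n : ℕ) {x y : A.Ob} (f : (F.quiv n).carrier x y) :
    F.lift n x y (Submodule.Quotient.mk f) = (f : A.Hom x y) - F.retr n x y f := rfl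

theorem lift_mem (n : ℕ) {x y : A.Ob} (c : F.Quot n x y) :
    F.lift n x y c ∈ (F.compl n).carrier x y := by
  obtain ⟨f, rfl⟩ := Submodule.Quotient.mk_surjective _ c
  exact F.sub_retr_mem n f

/-- The generator with a given label. -/
def gen (x y : A.Ob) (l : F.Label x y) : A.Hom x y :=
  A.proj x y l.degree (F.lift l.stage x y (F.basis l.stage x y l.index))

theorem gen_mem_compl {x y : A.Ob} (l : F.Label x y) :
    F.gen x y l ∈ (F.compl (F.stage x y l)).carrier x y :=
  (F.compl _).proj_mem _ (F.lift_mem _ _)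

theorem gen_mem_gr {x y : A.Ob} (l : F.Label x y) :
    F.gen x y l ∈ A.gr x y (F.labelDeg x y l) := A.proj_mem _ _

/-- The value of a tree of generators, or of a unit. -/
def evalBasis : ∀ {x y : A.Ob}, UTree F.Label x y → A.Hom x y
  | _, _, .unit x => e x
  | _, _, .tree t => t.fold A.m F.gen

/-- The strict functor to `A` which is given on the generators. -/
def evalLin (x y : A.Ob) : Lin R (UTree F.Label) x y →ₗ[R] A.Hom x y :=
  Finsupp.linearCombination R F.evalBasis

theorem evalLin_single {x y : A.Ob} (u : UTree F.Label x y) :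
    F.evalLin x y (Finsupp.single u 1) = F.evalBasis u := by
  simp [evalLin]

theorem fold_gen_mem_gr {x y : A.Ob} (t : PTree F.Label x y) :
    t.fold A.m F.gen ∈ A.gr x y (t.deg F.labelDeg) := by
  refine PTree.induction (P := fun x y t => t.fold A.m F.gen ∈ A.gr x y (t.deg F.labelDeg)) ?_ ?_ t
  · intro x y l
    rw [PTree.fold_leaf, PTree.deg_leaf]
    exact F.gen_mem_gr l
  · intro x y z w t₁ t₂ s h₁ h₂ h
    rw [PTree.fold_node, PTree.deg_node]
    exact m_mem_of_all (A := A) (s := .cons t₁ (.cons t₂ s))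
      (d := fun x y (t : PTree F.Label x y) => t.deg F.labelDeg) ⟨h₁, h₂, h⟩

theorem evalBasis_mem_gr (he : A.IsStrictUnit e) {x y : A.Ob} (u : UTree F.Label x y) :
    F.evalBasis u ∈ A.gr x y (u.deg F.labelDeg) := by
  cases u with
  | unit => exact he.mem x
  | tree t => exact F.fold_gen_mem_gr t

/-- On strings of trees this is the recursion defining `fold`; on strings containing a unit both
sides follow the strict unit axioms. Length at least two is essential, since `basisOp` vanishes on a
single arrow while `m¹` need not. -/
theorem evalLin_basisOp (he : A.IsStrictUnit e) {x y : A.Ob} (s : Str (UTree F.Label) x y)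
    (hs : 2 ≤ s.length) : F.evalLin x y (UTree.basisOp R F.labelDeg s) =
      A.m (s.map fun _ _ u => F.evalBasis u) := by
  by_cases h : s.All fun _ _ u => u.IsTree
  · obtain ⟨s, rfl⟩ := UTree.exists_eq_map h
    match s, hs with
    | .cons t₁ (.cons t₂ s), _ =>
      rw [UTree.basisOp_tree, evalLin_single, Str.map_map]
      exact PTree.fold_node A.m F.gen t₁ t₂ s
  · obtain ⟨z, p, q, rfl⟩ : ∃ (z : A.Ob) (p : Str (UTree F.Label) x z)
        (q : Str (UTree F.Label) z y), s = p.append (.cons (.unit z) q) := by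
      clear hs
      induction s with
      | nil => exact (h trivial).elim
      | cons u s ih =>
        cases u with
        | unit => exact ⟨_, .nil _, s, rfl⟩
        | tree t =>
          obtain ⟨z, p, q, rfl⟩ := ih fun h' => h ⟨trivial, h'⟩
          exact ⟨z, .cons (.tree t) p, q, rfl⟩
    by_cases hl : 2 ≤ p.length + q.length
    · rw [UTree.basisOp_unit_higher R _ _ _ hl, map_zero, Str.map_append]
      exact (he.higher _ _ (by rwa [Str.length_map, Str.length_map])).symm
    · match p, q, hl, hs with
      | .nil _, .nil _, _, hs => simp [Str.append, Str.length] at hs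
      | .nil _, .cons f (.nil _), _, _ =>
        rw [Str.append, UTree.basisOp_unit_left, evalLin_single]
        exact (he.right _).symm
      | .cons f (.nil _), .nil _, _, _ =>
        rw [Str.append, Str.append, UTree.basisOp_unit_right, Units.smul_def, map_zsmul,
          evalLin_single]
        exact (he.left _ _ (F.evalBasis_mem_gr he f)).symm
      | .nil _, .cons f (.cons _ _), hl, _ => simp [Str.length] at hl
      | .cons f (.nil _), .cons _ _, hl, _ => simp [Str.length] at hl
      | .cons f (.cons _ _), q, hl, _ => simp [Str.length] at hl; omega

theorem evalLin_op (he : A.IsStrictUnit e) {x y : A.Ob} (s : Str (Lin R (UTree F.Label)) x y)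
    (hs : 2 ≤ s.length) : F.evalLin x y (UTree.op R F.labelDeg s) = A.m (s.map fun x y f => F.evalLin x y f) := by
  refine Str.span_induction (R := R) (H := Lin R (UTree F.Label))
    (P := fun {x y} s => 2 ≤ s.length →
      F.evalLin x y (UTree.op R F.labelDeg s) = A.m (s.map fun x y f => F.evalLin x y f))
    (fun x y => Set.range fun u => Finsupp.single u 1) ?_ ?_ ?_ ?_ ?_ s hs
  · intro x y
    simpa using (Finsupp.basisSingleOne (R := R) (ι := UTree F.Label x y)).span_eq
  · intro x y s hG hs
    obtain ⟨s, rfl⟩ : ∃ s' : Str (UTree F.Label) x y, s = s'.map fun _ _ u => Finsupp.single u 1 := by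
      clear hs
      induction s with
      | nil x => exact ⟨.nil x, rfl⟩
      | cons f s ih =>
        obtain ⟨⟨u, rfl⟩, h⟩ := hG
        obtain ⟨s', rfl⟩ := ih h
        exact ⟨.cons u s', rfl⟩
    rw [UTree.op_single, Str.map_map, F.evalLin_basisOp he s (by rwa [Str.length_map] at hs)]
    simp only [evalLin_single]
  · intro x y z w p q _
    rw [UTree.op, Str.extend_zero, Str.map_append, Str.map, map_zero, map_zero, A.m_zero]
  · intro x y z w p f g q hf hg hl
    simp only [Str.length_append, Str.length] at hf hg hl
    rw [UTree.op, Str.extend_add, Str.map_append, Str.map, map_add, map_add, A.m_add]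
    have hf := hf hl
    have hg := hg hl
    rw [UTree.op, Str.map_append, Str.map] at hf hg
    rw [hf, hg]
  · intro x y z w p r f q hf hl
    simp only [Str.length_append, Str.length] at hf hl
    rw [UTree.op, Str.extend_smul, Str.map_append, Str.map, map_smul, map_smul, A.m_smul]
    have hf := hf hl
    rw [UTree.op, Str.map_append, Str.map] at hf
    rw [hf]

end SemiFreeFiltration
end AInfCat

-- Extension of a strict section along a free extension

theorem exists_factor_through_range {R M N P : Type*} [CommRing R] [AddCommGroup M] [Module R M]
    [AddCommGroup N] [Module R N] [AddCommGroup P] [Module R P] (f : M →ₗ[R] N) (g : M →ₗ[R] P)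
    {D : Submodule R N} (hD : LinearMap.range f = D) (h : ∀ a, f a = 0 → g a = 0) :
    ∃ k : D →ₗ[R] P, ∀ a (ha : f a ∈ D), k ⟨f a, ha⟩ = g a := by
  subst hD
  refine ⟨(LinearMap.ker f).liftQ g (fun a ha => h a ha) ∘ₗ f.quotKerEquivRange.symm.toLinearMap,
    fun a ha => ?_⟩
  have : f.quotKerEquivRange.symm ⟨f a, ha⟩ = Submodule.Quotient.mk a := by
    rw [LinearEquiv.symm_apply_eq]; rfl
  simp only [LinearMap.comp_apply, LinearEquiv.coe_coe, this]
  exact Submodule.liftQ_apply _ _ _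

namespace AInfCat
namespace SemiFreeFiltration

variable {R : Type u} [CommRing R] {A : AInfCat R} {e : ∀ x, A.Hom x x}
  (F : A.SemiFreeFiltration e)

/-- The hom-spaces of the `n`-th subcategory. -/
abbrev SubHom (n : ℕ) (x y : A.Ob) : Type u := (F.sub n).carrier x y

/-- `σ` is a strict section, on the `n`-th subcategory, of the functor `evalLin`. -/
structure IsSection (n : ℕ) (σ : ∀ x y, F.SubHom n x y →ₗ[R] Lin R (UTree F.Label) x y) :
    Prop where
  unit : ∀ x, σ x x ⟨e x, F.unit_mem n x⟩ = Finsupp.single (.unit x) 1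
  strict : ∀ {x y : A.Ob} (s : Str (F.SubHom n) x y)
    (h : A.m (s.map fun _ _ f => f.1) ∈ (F.sub n).carrier x y), 2 ≤ s.length →
    σ x y ⟨_, h⟩ = UTree.op R F.labelDeg (s.map fun x y f => σ x y f)
  deg : ∀ {x y : A.Ob} (i : ℤ) (f : F.SubHom n x y), (f : A.Hom x y) ∈ A.gr x y i →
    σ x y f ∈ Finsupp.supported R R {u | u.deg F.labelDeg = i}
  eval : ∀ {x y : A.Ob} (f : F.SubHom n x y), F.evalLin x y (σ x y f) = f
  low : ∀ {x y : A.Ob} (f : F.SubHom n x y),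
    σ x y f ∈ Finsupp.supported R R {u | u.rank F.stage ∈ Rank.lowDegree n}

section Step

variable {F} {n : ℕ} {σ : ∀ x y, F.SubHom n x y →ₗ[R] Lin R (UTree F.Label) x y}

variable (F n) in
/-- The coordinates of an element of degree `i` of the `n`-th quiver with respect to the
generators. -/
def coords (i : ℤ) (x y : A.Ob) : (F.quiv n).carrier x y →ₗ[R] Lin R (UTree F.Label) x y :=
  Finsupp.lmapDomain R R (fun s => UTree.tree (.leaf (⟨n, s, i⟩ : F.Label x y))) ∘ₗ
    (F.basis n x y).repr.toLinearMap ∘ₗ Submodule.mkQ _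

variable (σ) in
/-- The extension of `σ` to the elements of degree `i` of the `n`-th quiver. -/
def quivMap (i : ℤ) (x y : A.Ob) : (F.quiv n).carrier x y →ₗ[R] Lin R (UTree F.Label) x y :=
  σ x y ∘ₗ F.retr n x y + F.coords n i x y

theorem coords_of_mem {i : ℤ} {x y : A.Ob} {f : (F.quiv n).carrier x y}
    (hf : (f : A.Hom x y) ∈ (F.sub n).carrier x y) : F.coords n i x y f = 0 := by
  have : Submodule.mkQ (((F.sub n).carrier x y).submoduleOf ((F.quiv n).carrier x y)) f = 0 :=
    (Submodule.Quotient.mk_eq_zero _).2 hf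
  simp only [coords, LinearMap.comp_apply, this, map_zero]

theorem coords_mem (i : ℤ) {x y : A.Ob} (f : (F.quiv n).carrier x y) :
    F.coords n i x y f ∈ Finsupp.supported R R
      {u | ∃ s, u = UTree.tree (.leaf (⟨n, s, i⟩ : F.Label x y))} := by
  classical
  intro u hu
  obtain ⟨s, -, rfl⟩ := Finset.mem_image.1 (Finsupp.mapDomain_support hu)
  exact ⟨s, rfl⟩

/-- The labels carry the degree `i`, so evaluating the coordinates returns only the degree-`i` part
of the complement component; for `f` homogeneous of degree `i` nothing is lost. -/
theorem evalLin_coords (i : ℤ) {x y : A.Ob} (f : (F.quiv n).carrier x y) :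
    F.evalLin x y (F.coords n i x y f) = A.proj x y i (f - F.retr n x y f) := by
  have h : F.evalLin x y ∘ₗ
      Finsupp.lmapDomain R R (fun s => UTree.tree (.leaf (⟨n, s, i⟩ : F.Label x y))) =
      A.proj x y i ∘ₗ F.lift n x y ∘ₗ (F.basis n x y).repr.symm.toLinearMap := by
    refine Finsupp.lhom_ext' fun s => LinearMap.ext_ring ?_
    simp only [LinearMap.comp_apply, Finsupp.lsingle_apply, Finsupp.lmapDomain_apply,
      Finsupp.mapDomain_single, evalLin_single, LinearEquiv.coe_coe, Module.Basis.repr_symm_single,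
      one_smul]
    exact PTree.fold_leaf _ _ _
  have := LinearMap.congr_fun h ((F.basis n x y).repr (Submodule.Quotient.mk f))
  simp only [LinearMap.comp_apply, LinearEquiv.coe_coe, LinearEquiv.symm_apply_apply, lift_mk]
    at this
  exact this

theorem quivMap_of_mem (i : ℤ) {x y : A.Ob} {f : (F.quiv n).carrier x y}
    (hf : (f : A.Hom x y) ∈ (F.sub n).carrier x y) : quivMap σ i x y f = σ x y ⟨f, hf⟩ := by
  simp only [quivMap, LinearMap.add_apply, LinearMap.comp_apply, F.retr_of_mem n hf,
    coords_of_mem hf, add_zero]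

theorem quivMap_of_mem_compl (i : ℤ) {x y : A.Ob} {f : (F.quiv n).carrier x y}
    (hf : (f : A.Hom x y) ∈ (F.compl n).carrier x y) : quivMap σ i x y f = F.coords n i x y f := by
  simp only [quivMap, LinearMap.add_apply, LinearMap.comp_apply, F.retr_of_mem_compl n hf,
    map_zero, zero_add]

variable (σ) in
/-- The values of the leaves of the trees of the free extension. -/
def leafMap (x y : A.Ob) (f : (F.quiv n).Elt x y) : Lin R (UTree F.Label) x y :=
  quivMap σ f.1 x y ⟨f.2.1, f.2.2.1⟩

variable (σ) in
/-- The values of the trees of the free extension. -/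
def treeMap (x y : A.Ob) (t : PTree (F.quiv n).Elt x y) : Lin R (UTree F.Label) x y :=
  t.fold (UTree.op R F.labelDeg) (leafMap σ)

variable (σ) in
/-- The linear extension of `treeMap`. -/
def treeLin (x y : A.Ob) : (PTree (F.quiv n).Elt x y →₀ R) →ₗ[R] Lin R (UTree F.Label) x y :=
  Finsupp.linearCombination R (treeMap σ x y)

theorem treeMap_leaf {x y : A.Ob} (f : (F.quiv n).Elt x y) :
    treeMap σ x y (.leaf f) = leafMap σ x y f := PTree.fold_leaf _ _ _

theorem treeMap_node {x y z w : A.Ob} (t₁ : PTree (F.quiv n).Elt x y)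
    (t₂ : PTree (F.quiv n).Elt y z) (s : Str (PTree (F.quiv n).Elt) z w) :
    treeMap σ x w (.node t₁ t₂ s) =
      UTree.op R F.labelDeg ((Str.cons t₁ (.cons t₂ s)).map (treeMap σ)) :=
  PTree.fold_node _ _ _ _ _

theorem treeLin_single {x y : A.Ob} (t : PTree (F.quiv n).Elt x y) :
    treeLin σ x y (Finsupp.single t 1) = treeMap σ x y t := by simp [treeLin]

theorem treeLin_graft {x y : A.Ob} (s : Str (PTree (F.quiv n).Elt) x y) :
    treeLin σ x y (PTree.graft R s) = UTree.op R F.labelDeg (s.map (treeMap σ)) := by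
  match s with
  | .nil _ => rw [PTree.graft, map_zero]; rfl
  | .cons t (.nil _) =>
    rw [PTree.graft_of_length_lt R (by simp [Str.length]), map_zero,
      UTree.op_of_length_lt _ (by simp [Str.length, Str.map])]
  | .cons t₁ (.cons t₂ s) => rw [PTree.graft, treeLin_single, treeMap_node]

/-- Insertion into a grafting becomes an operation with one slot varying, so by multilinearity the
kernel of `treeLin` is stable under grafting. -/
theorem treeLin_insert {x y z w : A.Ob} (p : Str (PTree (F.quiv n).Elt) x y)
    (q : Str (PTree (F.quiv n).Elt) z w) (a : PTree (F.quiv n).Elt y z →₀ R) :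
    treeLin σ x w (PTree.insert R p q a) = UTree.op R F.labelDeg
      ((p.map (treeMap σ)).append (.cons (treeLin σ y z a) (q.map (treeMap σ)))) := by
  induction a using Finsupp.induction_linear with
  | zero => rw [map_zero, map_zero, map_zero, UTree.op, Str.extend_zero]
  | add a b ha hb =>
    rw [map_add, map_add, map_add, ha, hb]
    exact (Str.extend_add _ _ _ _ _).symm
  | single t r =>
    have h : (Finsupp.single t r : PTree (F.quiv n).Elt y z →₀ R) = r • Finsupp.single t 1 := by
      simp
    rw [h, map_smul, map_smul, map_smul]
    refine Eq.trans ?_ (Str.extend_smul _ _ _ _ _).symm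
    congr 1
    rw [PTree.insert, Finsupp.linearCombination_single, one_smul, treeLin_graft, treeLin_single,
      Str.map_append]
    rfl

/-- The recorded degree of a leaf enters only through its coordinates, and these vanish on the
subcategory. The separate `g` allows rewriting along equalities in `A`. -/
theorem leafMap_of_mem {x y : A.Ob} {f : (F.quiv n).Elt x y} {g : A.Hom x y}
    (hfg : (f.2 : A.Hom x y) = g) (hg : g ∈ (F.sub n).carrier x y) :
    leafMap σ x y f = σ x y ⟨g, hg⟩ := by
  subst hfg
  exact quivMap_of_mem _ (f := ⟨f.2.1, f.2.2.1⟩) hg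

theorem treeMap_unit (hσ : F.IsSection n σ) {x : A.Ob} {u : (F.quiv n).Elt x x}
    (hu : (u.2 : A.Hom x x) = e x) : treeMap σ x x (.leaf u) = Finsupp.single (.unit x) 1 := by
  rw [treeMap_leaf, leafMap_of_mem hu (F.unit_mem n x), hσ.unit]

theorem leafMap_deg (hσ : F.IsSection n σ) {x y : A.Ob} (f : (F.quiv n).Elt x y) :
    leafMap σ x y f ∈ Finsupp.supported R R {u | u.deg F.labelDeg = f.1} := by
  refine Submodule.add_mem _ (hσ.deg _ _ (F.retr_mem_gr n (f := ⟨f.2.1, f.2.2.1⟩) f.2.2.2)) ?_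
  refine Finsupp.supported_mono ?_ (coords_mem f.1 _)
  rintro _ ⟨s, rfl⟩
  exact PTree.deg_leaf _ _

theorem treeMap_deg (hσ : F.IsSection n σ) {x y : A.Ob} (t : PTree (F.quiv n).Elt x y) :
    treeMap σ x y t ∈
      Finsupp.supported R R {u | u.deg F.labelDeg = t.deg fun _ _ f => f.1} := by
  refine PTree.induction (P := fun x y t => treeMap σ x y t ∈
    Finsupp.supported R R {u | u.deg F.labelDeg = t.deg fun _ _ f => f.1}) ?_ ?_ t
  · intro x y f
    rw [treeMap_leaf, PTree.deg_leaf]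
    exact leafMap_deg hσ f
  · intro x y z w t₁ t₂ s h₁ h₂ h
    have hs : (Str.cons t₁ (.cons t₂ s)).All fun x y t => treeMap σ x y t ∈
        Finsupp.supported R R {u | u.deg F.labelDeg = t.deg fun _ _ f => f.1} := ⟨h₁, h₂, h⟩
    rw [treeMap_node, PTree.deg_node]
    exact UTree.op_mem_deg F.labelDeg (φ := treeMap σ)
      (d' := fun x y (t : PTree (F.quiv n).Elt x y) => t.deg fun _ _ f => f.1) hs

theorem treeMap_low (hσ : F.IsSection n σ) {x y : A.Ob} (t : PTree (F.quiv n).Elt x y) :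
    treeMap σ x y t ∈
      Finsupp.supported R R {u | u.rank F.stage ∈ Rank.lowDegree (n + 1)} := by
  refine PTree.induction (P := fun x y t => treeMap σ x y t ∈
    Finsupp.supported R R {u | u.rank F.stage ∈ Rank.lowDegree (n + 1)}) ?_ ?_ t
  · intro x y f
    rw [treeMap_leaf]
    refine Submodule.add_mem _ (Finsupp.supported_mono ?_ (hσ.low _))
      (Finsupp.supported_mono ?_ (coords_mem f.1 _))
    · exact fun u hu => Rank.lowDegree_mono (Nat.le_succ n) hu
    · rintro _ ⟨s, rfl⟩
      have h : PTree.rank F.stage (.leaf (⟨n, s, f.1⟩ : F.Label x y)) ∈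
          Rank.lowDegree (n + 1) := by
        rw [PTree.rank_leaf]
        exact Rank.pow_mem_lowDegree le_rfl
      exact h
  · intro x y z w t₁ t₂ s h₁ h₂ h
    rw [treeMap_node]
    exact UTree.op_mem_lowDegree (s := .cons t₁ (.cons t₂ s)) _ _ ⟨h₁, h₂, h⟩

theorem evalLin_treeMap (he : A.IsStrictUnit e) (hσ : F.IsSection n σ) {x y : A.Ob}
    (t : PTree (F.quiv n).Elt x y) :
    F.evalLin x y (treeMap σ x y t) = (F.quiv n).evalTree t := by
  rw [GrSubquiver.evalTree_eq_fold]
  refine PTree.induction (P := fun x y t => F.evalLin x y (treeMap σ x y t) =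
    t.fold A.m fun _ _ f => f.2.1) ?_ ?_ t
  · intro x y f
    rw [treeMap_leaf, PTree.fold_leaf]
    simp only [leafMap, quivMap, LinearMap.add_apply, LinearMap.comp_apply, map_add, hσ.eval,
      evalLin_coords]
    have h := F.retr_mem_gr n (f := ⟨f.2.1, f.2.2.1⟩) f.2.2.2
    rw [A.proj_self (Submodule.sub_mem _ f.2.2.2 h)]
    abel
  · intro x y z w t₁ t₂ s h₁ h₂ h
    rw [treeMap_node, F.evalLin_op he _ (by simp [Str.map, Str.length]), PTree.fold_node,
      Str.map_map]
    congr 1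
    exact Str.map_congr ⟨h₁, h₂, h⟩

theorem evalLin_treeLin (he : A.IsStrictUnit e) (hσ : F.IsSection n σ) {x y : A.Ob}
    (a : PTree (F.quiv n).Elt x y →₀ R) :
    F.evalLin x y (treeLin σ x y a) = (F.quiv n).eval x y a := by
  have : F.evalLin x y ∘ₗ treeLin σ x y = (F.quiv n).eval x y := by
    refine Finsupp.lhom_ext' fun t => LinearMap.ext_ring ?_
    simp only [LinearMap.comp_apply, Finsupp.lsingle_apply, treeLin_single,
      evalLin_treeMap he hσ, GrSubquiver.eval, Finsupp.linearCombination_single, one_smul]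
  exact LinearMap.congr_fun this a

theorem treeLin_linRel {x y : A.Ob} {a : PTree (F.quiv n).Elt x y →₀ R}
    (h : (F.quiv n).LinRel x y a) : treeLin σ x y a = 0 := by
  cases h with
  | add i f g =>
    have h : leafMap σ x y ⟨i, f + g⟩ = leafMap σ x y ⟨i, f⟩ + leafMap σ x y ⟨i, g⟩ :=
      by
      unfold leafMap
      rw [← map_add]
      rfl
    rw [map_sub, map_sub, treeLin_single, treeLin_single, treeLin_single, treeMap_leaf,
      treeMap_leaf, treeMap_leaf, h]
    abel
  | smul i r f =>
    have h : leafMap σ x y ⟨i, r • f⟩ = r • leafMap σ x y ⟨i, f⟩ :=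
      by
      unfold leafMap
      rw [← map_smul]
      rfl
    rw [map_sub, map_smul, treeLin_single, treeLin_single, treeMap_leaf, treeMap_leaf, h,
      sub_self]

/-- A string in the subcategory is mapped by `leafMap` as by `σ`, so the relation becomes the
strictness of `σ`. -/
theorem treeLin_subcatRel (hσ : F.IsSection n σ) {x y : A.Ob}
    {a : PTree (F.quiv n).Elt x y →₀ R} (h : (F.quiv n).SubcatRel (F.sub n) x y a) :
    treeLin σ x y a = 0 := by
  obtain ⟨s, g, hs, hC, hg⟩ := h
  have hlift : ∀ {x y : A.Ob} (s : Str (F.quiv n).Elt x y),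
      s.All (fun x y f => (f.2 : A.Hom x y) ∈ (F.sub n).carrier x y) →
      ∃ s' : Str (F.SubHom n) x y,
        (s'.map fun _ _ f => f.1) = (s.map fun _ _ f => (f.2 : A.Hom _ _)) ∧
        (s'.map fun x y f => σ x y f) = s.map (leafMap σ) := by
    intro x y s hC
    induction s with
    | nil x => exact ⟨.nil x, rfl, rfl⟩
    | cons f s ih =>
      obtain ⟨s', h1, h2⟩ := ih hC.2
      refine ⟨.cons ⟨_, hC.1⟩ s', congrArg _ h1, ?_⟩
      simp only [Str.map, h2]
      rw [leafMap_of_mem rfl hC.1]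
  obtain ⟨s', h1, h2⟩ := hlift s hC
  have hm : A.m (s'.map fun _ _ f => f.1) ∈ (F.sub n).carrier _ _ :=
    F.sub_isSubcategory n _ (Str.all_map.2 (Str.all_of_forall (fun _ _ f => f.2) s'))
  rw [map_sub, sub_eq_zero, treeLin_single, treeLin_graft, treeMap_leaf,
    leafMap_of_mem (hg.trans (congrArg A.m h1.symm)) hm, hσ.strict s' hm, h2, Str.map_map]
  · simp only [treeMap_leaf]
  · rw [← Str.length_map (fun x y f => σ x y f), h2, Str.length_map]; exact hs

theorem treeLin_unitRel (hσ : F.IsSection n σ) {x y : A.Ob}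
    {a : PTree (F.quiv n).Elt x y →₀ R} (h : (F.quiv n).UnitRel e x y a) :
    treeLin σ x y a = 0 := by
  cases h with
  | right u hu t =>
    rw [map_sub, sub_eq_zero, treeLin_graft, treeLin_single]
    simp only [Str.map, treeMap_unit hσ hu]
    exact UTree.op_unit_left _ _
  | left u hu t =>
    rw [map_sub, sub_eq_zero, treeLin_graft, Units.smul_def, map_zsmul, treeLin_single]
    simp only [Str.map, treeMap_unit hσ hu]
    exact UTree.op_unit_right _ (treeMap_deg hσ t)
  | higher u hu p q h =>
    rw [treeLin_graft, Str.map_append]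
    simp only [Str.map, treeMap_unit hσ hu]
    exact UTree.op_unit_higher _ _ _ (by rwa [Str.length_map, Str.length_map])

/-- With the kernel description in `IsFreeExtension`, this makes `treeLin` descend from formal trees
to the next subcategory. -/
theorem treeLin_eq_zero_of_ideal (hσ : F.IsSection n σ) {x y : A.Ob}
    {a : PTree (F.quiv n).Elt x y →₀ R}
    (ha : PTree.Ideal (fun x y a => (F.quiv n).LinRel x y a ∨
      (F.quiv n).SubcatRel (F.sub n) x y a ∨ (F.quiv n).UnitRel e x y a) x y a) :
    treeLin σ x y a = 0 := by
  induction ha with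
  | base a h =>
    rcases h with h | h | h
    · exact treeLin_linRel h
    · exact treeLin_subcatRel hσ h
    · exact treeLin_unitRel hσ h
  | zero => exact map_zero _
  | add a b _ _ ha hb => rw [map_add, ha, hb, add_zero]
  | smul r a _ ha => rw [map_smul, ha, smul_zero]
  | insert p q a _ ha =>
    rw [treeLin_insert, ha]
    exact Str.extend_zero _ _ _

theorem eval_single (Q : A.GrSubquiver) {x y : A.Ob} (t : PTree Q.Elt x y) :
    Q.eval x y (Finsupp.single t 1) = Q.evalTree t := by
  simp [GrSubquiver.eval]

theorem evalTree_mem {x y : A.Ob} (t : PTree (F.quiv n).Elt x y) :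
    (F.quiv n).evalTree t ∈ (F.sub (n + 1)).carrier x y := by
  rw [← (F.free_extension n x y).1, ← eval_single]
  exact LinearMap.mem_range_self _ _

/-- The compatibility with the operations can be checked on generators. -/
theorem strict_of_generators {σ' : ∀ x y, F.SubHom n x y →ₗ[R] Lin R (UTree F.Label) x y}
    (G : ∀ x y, Set (F.SubHom n x y)) (hG : ∀ x y, Submodule.span R (G x y) = ⊤)
    (gen : ∀ {x y : A.Ob} (s : Str (F.SubHom n) x y), s.All (fun x y f => f ∈ G x y) →
      ∀ h : A.m (s.map fun _ _ f => f.1) ∈ (F.sub n).carrier x y, 2 ≤ s.length →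
      σ' x y ⟨_, h⟩ = UTree.op R F.labelDeg (s.map fun x y f => σ' x y f))
    {x y : A.Ob} (s : Str (F.SubHom n) x y)
    (h : A.m (s.map fun _ _ f => f.1) ∈ (F.sub n).carrier x y) (hs : 2 ≤ s.length) :
    σ' x y ⟨_, h⟩ = UTree.op R F.labelDeg (s.map fun x y f => σ' x y f) := by
  have hsub : ∀ {x y : A.Ob} (s : Str (F.SubHom n) x y),
      A.m (s.map fun _ _ f => f.1) ∈ (F.sub n).carrier x y := fun s =>
    F.sub_isSubcategory n _ (Str.all_map.2 (Str.all_of_forall (fun _ _ f => f.2) s))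
  have hmap : ∀ {x y z w : A.Ob} (p : Str (F.SubHom n) x y) (f : F.SubHom n y z)
      (q : Str (F.SubHom n) z w), ((p.append (.cons f q)).map fun x y f => σ' x y f) =
      (p.map fun x y f => σ' x y f).append (.cons (σ' y z f) (q.map fun x y f => σ' x y f)) :=
    fun p f q => Str.map_append _ _ _
  refine Str.span_induction (R := R) (H := F.SubHom n)
    (P := fun {x y} s => 2 ≤ s.length → σ' x y ⟨_, hsub s⟩ =
      UTree.op R F.labelDeg (s.map fun x y f => σ' x y f))
    G hG (fun s hs => gen s hs (hsub s)) ?_ ?_ ?_ s hs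
  · intro x y z w p q _
    rw [hmap, map_zero]
    refine Eq.trans ?_ (Str.extend_zero _ _ _).symm
    rw [← map_zero (σ' x w)]
    congr 1
    apply Subtype.ext
    simp only [Str.map_append, Str.map]
    exact A.m_zero _ _
  · intro x y z w p f g q hf hg hl
    have hf := hf (by simpa only [Str.length_append, Str.length] using hl)
    have hg := hg (by simpa only [Str.length_append, Str.length] using hl)
    rw [hmap] at hf hg ⊢
    rw [map_add]
    refine Eq.trans ?_ (Str.extend_add _ _ _ _ _).symm
    refine Eq.trans ?_ (congrArg₂ (· + ·) hf hg)
    rw [← map_add]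
    congr 1
    apply Subtype.ext
    simp only [Str.map_append, Str.map, Submodule.coe_add]
    exact A.m_add _ _ _ _
  · intro x y z w p r f q hf hl
    have hf := hf (by simpa only [Str.length_append, Str.length] using hl)
    rw [hmap] at hf ⊢
    rw [map_smul]
    refine Eq.trans ?_ (Str.extend_smul _ _ _ _ _).symm
    refine Eq.trans ?_ (congrArg (r • ·) hf)
    rw [← map_smul]
    congr 1
    apply Subtype.ext
    simp only [Str.map_append, Str.map, Submodule.coe_smul]
    exact A.m_smul _ _ _ _

/-- A strict section extends from each subcategory to the next one. -/
theorem IsSection.exists_extension (he : A.IsStrictUnit e) (hσ : F.IsSection n σ) :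
    ∃ σ' : ∀ x y, F.SubHom (n + 1) x y →ₗ[R] Lin R (UTree F.Label) x y,
      F.IsSection (n + 1) σ' ∧
      (∀ {x y : A.Ob} (f : A.Hom x y) (h : f ∈ (F.sub n).carrier x y)
        (h' : f ∈ (F.sub (n + 1)).carrier x y), σ' x y ⟨f, h'⟩ = σ x y ⟨f, h⟩) ∧
      ∀ {x y : A.Ob} (l : F.Label x y) (_ : F.stage x y l = n)
        (h : F.gen x y l ∈ (F.sub (n + 1)).carrier x y), σ' x y ⟨_, h⟩ ∈
        Finsupp.supported R R {u | u.rank F.stage ≤ Rank.pow (n + 1)} := by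
  -- An element of the next subcategory is the value of a combination of trees, unique modulo the
  -- ideal; `σ'` sends it to the `treeLin` of that combination.
  choose σ' hσ' using fun x y => exists_factor_through_range ((F.quiv n).eval x y) (treeLin σ x y)
    (F.free_extension n x y).1
    (fun a ha => treeLin_eq_zero_of_ideal hσ (((F.free_extension n x y).2 a).1 ha))
  have htree : ∀ {x y : A.Ob} (t : PTree (F.quiv n).Elt x y) (f : A.Hom x y)
      (h : f ∈ (F.sub (n + 1)).carrier x y), (F.quiv n).evalTree t = f →
      σ' x y ⟨f, h⟩ = treeMap σ x y t := by
    rintro x y t _ h rfl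
    have h' := h
    rw [← eval_single] at h'
    rw [← treeLin_single, ← hσ' x y _ h']
    congr 2
    rw [eval_single]
  have hleaf : ∀ {x y : A.Ob} (f : (F.quiv n).Elt x y) (g : A.Hom x y)
      (h : g ∈ (F.sub (n + 1)).carrier x y), (f.2 : A.Hom x y) = g →
      σ' x y ⟨g, h⟩ = leafMap σ x y f := by
    intro x y f g h hfg
    rw [htree (.leaf f) g h (by rw [GrSubquiver.evalTree]; exact hfg), treeMap_leaf]
  have hext : ∀ {x y : A.Ob} (f : A.Hom x y) (h : f ∈ (F.sub n).carrier x y)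
      (h' : f ∈ (F.sub (n + 1)).carrier x y), σ' x y ⟨f, h'⟩ = σ x y ⟨f, h⟩ := by
    intro x y f h h'
    -- Leaves are homogeneous, so `hleaf` applies only to homogeneous elements; the general case is
    -- reduced to components, which stay in `sub n`.
    have key : σ' x y ∘ₗ Submodule.inclusion (F.sub_mono (Nat.le_succ n) x y) = σ x y := by
      refine LinearMap.ext fun ⟨f, hf⟩ => ?_
      obtain ⟨s, hs⟩ := A.exists_sum_proj f
      have hs' : (⟨f, hf⟩ : F.SubHom n x y) =
          ∑ i ∈ s, ⟨A.proj x y i f, (F.sub n).proj_mem i hf⟩ := by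
        apply Subtype.ext
        rw [Submodule.coe_sum]
        exact hs
      rw [hs', map_sum, map_sum]
      refine Finset.sum_congr rfl fun i _ => ?_
      have hi := (F.sub n).proj_mem i hf
      have hq := F.sub_le_quiv n x y hi
      refine (hleaf ⟨i, A.proj x y i f, hq, A.proj_mem i f⟩ _ _ rfl).trans ?_
      exact leafMap_of_mem rfl hi
    exact LinearMap.congr_fun key ⟨f, h⟩
  refine ⟨σ', ⟨?_, ?_, ?_, ?_, ?_⟩, hext, ?_⟩
  · intro x
    rw [hext _ (F.unit_mem n x), hσ.unit]
  · intro x y s h hs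
    -- The values of trees span, and on them strictness says that an operation applied to values of
    -- trees is the value of the grafted tree.
    refine strict_of_generators
      (fun x y => Set.range fun t => ⟨(F.quiv n).evalTree t, evalTree_mem t⟩) ?_ ?_ s h hs
    · intro x y
      rw [eq_top_iff]
      rintro ⟨f, hf⟩ -
      have hf' := hf
      rw [← (F.free_extension n x y).1] at hf'
      obtain ⟨a, rfl⟩ := hf'
      have : (⟨(F.quiv n).eval x y a, hf⟩ : F.SubHom (n + 1) x y) =
          ∑ t ∈ a.support, a t • ⟨(F.quiv n).evalTree t, evalTree_mem t⟩ := by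
        apply Subtype.ext
        rw [Submodule.coe_sum]
        simp only [GrSubquiver.eval, Finsupp.linearCombination_apply, Finsupp.sum,
          Submodule.coe_smul]
      rw [this]
      exact Submodule.sum_mem _ fun t _ =>
        Submodule.smul_mem _ _ (Submodule.subset_span ⟨t, rfl⟩)
    · intro x y s hG h hs
      obtain ⟨t, rfl⟩ : ∃ t : Str (PTree (F.quiv n).Elt) x y,
          s = t.map fun _ _ t => ⟨(F.quiv n).evalTree t, evalTree_mem t⟩ := by
        clear hs h
        induction s with
        | nil x => exact ⟨.nil x, rfl⟩
        | cons f s ih =>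
          obtain ⟨⟨t, rfl⟩, h⟩ := hG
          obtain ⟨s', rfl⟩ := ih h
          exact ⟨.cons t s', rfl⟩
      match t, hs with
      | .cons t₁ (.cons t₂ t), _ =>
        rw [htree (.node t₁ t₂ t), treeMap_node, Str.map_map]
        · congr 1
          exact Str.map_congr (Str.all_of_forall (fun x y t => (htree t _ _ rfl).symm) _)
        · rw [GrSubquiver.evalTree_eq_fold, PTree.fold_node, Str.map_map]
          simp only [GrSubquiver.evalTree_eq_fold]
  · rintro x y i ⟨f, hf⟩ hfi
    have hf' := hf
    rw [← (F.free_extension n x y).1] at hf'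
    obtain ⟨a, rfl⟩ := hf'
    change (F.quiv n).eval x y a ∈ _ at hfi
    -- Each tree has a homogeneous value, so for a value of degree `i` the trees of other degrees
    -- can be discarded from `a`.
    have ha : (F.quiv n).eval x y (a.filter fun t => (t.deg fun _ _ f => f.1) = i) =
        (F.quiv n).eval x y a := by
      rw [← A.proj_self hfi]
      simp only [GrSubquiver.eval, Finsupp.linearCombination_apply, Finsupp.sum, map_sum,
        map_smul, Finsupp.support_filter, Finset.sum_filter, Finsupp.filter_apply]
      refine Finset.sum_congr rfl fun t _ => ?_
      have ht : (F.quiv n).evalTree t ∈ A.gr x y (t.deg fun _ _ f => f.1) := by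
        rw [GrSubquiver.evalTree_eq_fold]
        refine PTree.induction (P := fun x y t => (t.fold A.m fun _ _ f => f.2.1) ∈
          A.gr x y (t.deg fun _ _ (f : (F.quiv n).Elt _ _) => f.1)) ?_ ?_ t
        · intro x y f
          rw [PTree.fold_leaf, PTree.deg_leaf]
          exact f.2.2.2
        · intro x y z w t₁ t₂ s h₁ h₂ h
          rw [PTree.fold_node, PTree.deg_node]
          exact m_mem_of_all (A := A) (s := .cons t₁ (.cons t₂ s))
            (d := fun x y (t : PTree (F.quiv n).Elt x y) => t.deg fun _ _ f => f.1) ⟨h₁, h₂, h⟩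
      rw [A.proj_of_mem ht]
      split_ifs <;> simp
    have hb : (F.quiv n).eval x y (a.filter fun t => (t.deg fun _ _ f => f.1) = i) ∈
        (F.sub (n + 1)).carrier x y := by rw [ha]; exact hf
    have : σ' x y ⟨_, hf⟩ = σ' x y ⟨_, hb⟩ := by congr 2; exact ha.symm
    rw [this, hσ', treeLin, Finsupp.linearCombination_apply]
    refine Submodule.sum_mem _ fun t ht => Submodule.smul_mem _ _ ?_
    have h2 := treeMap_deg hσ t
    rw [Finsupp.support_filter, Finset.mem_filter] at ht
    rwa [ht.2] at h2
  · rintro x y ⟨f, hf⟩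
    have hf' := hf
    rw [← (F.free_extension n x y).1] at hf'
    obtain ⟨a, rfl⟩ := hf'
    rw [hσ', evalLin_treeLin he hσ]
  · rintro x y ⟨f, hf⟩
    have hf' := hf
    rw [← (F.free_extension n x y).1] at hf'
    obtain ⟨a, rfl⟩ := hf'
    rw [hσ', treeLin, Finsupp.linearCombination_apply]
    exact Submodule.sum_mem _ fun t _ => Submodule.smul_mem _ _ (treeMap_low hσ t)
  · rintro x y l rfl h
    -- A generator lies in the complement, so its retraction vanishes and its image is a combination
    -- of one-leaf trees of the same stage. It need not be the leaf `l` itself.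
    have hc := F.gen_mem_compl l
    have hq := F.compl_le_quiv _ x y hc
    rw [hleaf ⟨F.labelDeg x y l, F.gen x y l, hq, F.gen_mem_gr l⟩ _ h rfl, leafMap,
      quivMap_of_mem_compl _ hc]
    refine Finsupp.supported_mono ?_ (coords_mem _ _)
    rintro _ ⟨s, rfl⟩
    exact (PTree.rank_leaf _ _).le

end Step

end SemiFreeFiltration
end AInfCat

-- Sums over splittings and the differential of an operation

namespace Str

variable {O : Type u} {H K : O → O → Type u}

/-- Modulo `N`, a sum over all the splittings `s = p ++ q` reduces to the term with `p` empty if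
the other terms lie in `N`. -/
theorem sum_splits_sub_mem' {M : Type*} [AddCommGroup M] (N : AddSubgroup M) {x y : O}
    (s : Str H x y) (φ : (Σ z : O, Str H x z × Str H z y) → M)
    (h : ∀ a ∈ s.splits, a.2.1.length ≠ 0 → φ a ∈ N) :
    (s.splits.map φ).sum - φ ⟨x, .nil x, s⟩ ∈ N := by
  cases s with
  | nil => simp [splits]
  | cons f s =>
    simp only [splits, List.map_cons, List.sum_cons, add_sub_cancel_left]
    refine N.list_sum_mem fun a ha => ?_
    obtain ⟨b, hb, rfl⟩ := List.mem_map.1 ha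
    refine h b (List.mem_cons_of_mem _ hb) ?_
    obtain ⟨c, -, rfl⟩ := List.mem_map.1 hb
    simp [length]

theorem exists_of_map_eq_append (φ : ∀ x y, H x y → K x y) :
    ∀ {x y z : O} {s : Str H x z} {p : Str K x y} {q : Str K y z}, s.map φ = p.append q →
    ∃ (p' : Str H x y) (q' : Str H y z), s = p'.append q' ∧ p = p'.map φ ∧ q = q'.map φ
  | _, _, _, s, .nil _, q, h => ⟨.nil _, s, rfl, rfl, h.symm⟩
  | _, _, _, .nil _, .cons _ _, q, h => by simp [map, append] at h
  | _, _, _, .cons f s, .cons g p, q, h => by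
      simp only [map, append, cons.injEq] at h
      obtain ⟨rfl, h1, h2⟩ := h
      obtain ⟨p', q', rfl, rfl, rfl⟩ := exists_of_map_eq_append φ (eq_of_heq h2)
      refine ⟨.cons f p', q', rfl, ?_, rfl⟩
      rw [← eq_of_heq h1]; rfl

end Str

namespace AInfCat

/-- By the `A∞`-relations, `m¹(mⁿ(fₙ, …, f₁))` lies in `N` if the other terms do. -/
theorem m₁_m_mem {R : Type u} [CommRing R] (A : AInfCat R) {x y : A.Ob}
    (N : AddSubgroup (A.Hom x y)) (s : Str (Homog A.gr) x y)
    (h : ∀ {z w : A.Ob} (p : Str (Homog A.gr) x z) (b : Str (Homog A.gr) z w)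
      (q : Str (Homog A.gr) w y), s = p.append (b.append q) → p.length + q.length ≠ 0 →
      A.m ((p.map fun _ _ f => (f.2 : A.Hom _ _)).append
        (.cons (A.m (b.map fun _ _ f => (f.2 : A.Hom _ _)))
          (q.map fun _ _ f => (f.2 : A.Hom _ _)))) ∈ N) :
    A.m₁ x y (A.m (s.map fun _ _ f => (f.2 : A.Hom _ _))) ∈ N := by
  have hterm : ∀ a ∈ s.splits, ∀ b ∈ a.2.2.splits, a.2.1.length + b.2.2.length ≠ 0 →
      Int.negOnePow (a.2.1.weight fun _ _ f => f.1 - 1) •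
        A.m ((a.2.1.map fun _ _ f => (f.2 : A.Hom _ _)).append
          (.cons (A.m (b.2.1.map fun _ _ f => (f.2 : A.Hom _ _)))
            (b.2.2.map fun _ _ f => (f.2 : A.Hom _ _)))) ∈ N := by
    intro a ha b hb hl
    rw [Units.smul_def]
    refine zsmul_mem (h _ _ _ ?_ hl) _
    rw [Str.append_eq_of_mem_splits hb, Str.append_eq_of_mem_splits ha]
  have hnil : (⟨x, .nil x, s⟩ : Σ z : A.Ob, Str (Homog A.gr) x z × Str (Homog A.gr) z y) ∈
      s.splits := by cases s <;> simp [Str.splits]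
  -- The term `m¹(mⁿ(…))` belongs to the splitting with empty prefix and empty suffix. `ho` isolates
  -- the empty prefix in the vanishing double sum, and `hi` then isolates the empty suffix.
  have ho := Str.sum_splits_sub_mem' N s _ fun a ha hl =>
    N.list_sum_mem fun c hc => by
      obtain ⟨b, hb, rfl⟩ := List.mem_map.1 hc
      exact hterm a ha b hb (by omega)
  rw [A.m_rel s, zero_sub, neg_mem_iff] at ho
  have hi := Str.sum_splits_sub_mem N s _ fun b hb hl => hterm _ hnil b hb (by omega)
  have hfin := N.sub_mem ho hi
  rw [sub_sub_cancel] at hfin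
  simp only [Str.weight, Int.negOnePow_zero, one_smul] at hfin
  exact hfin

-- The global strict section and the rank of the differential

namespace SemiFreeFiltration

variable {R : Type u} [CommRing R] {A : AInfCat R} {e : ∀ x, A.Hom x x}
  (F : A.SemiFreeFiltration e)

/-- On the discrete subcategory there is a strict section. -/
theorem exists_isSection_zero (he : A.IsStrictUnit e) : ∃ σ, F.IsSection 0 σ := by
  -- The second clause is an induction principle: a property of pairs `(f, k f)` need only be
  -- checked on multiples of units and on zero, which avoids repeating the case distinction `x = y`.
  have key : ∀ x y, ∃ k : F.SubHom 0 x y →ₗ[R] Lin R (UTree F.Label) x y,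
      (∀ (h : x = y) (h' : h ▸ e x ∈ (F.sub 0).carrier x y),
        k ⟨h ▸ e x, h'⟩ =
          h ▸ (Finsupp.single (UTree.unit x) 1 : Lin R (UTree F.Label) x x)) ∧
      ∀ P : ∀ x y, A.Hom x y → Lin R (UTree F.Label) x y → Prop,
        (∀ x (r : R), P x x (r • e x) (r • Finsupp.single (UTree.unit x) 1)) → (∀ x y, P x y 0 0) →
        ∀ f : F.SubHom 0 x y, P x y f.1 (k f) := by
    intro x y
    by_cases hxy : x = y
    · subst hxy
      obtain ⟨k, hk⟩ := exists_factor_through_range (LinearMap.toSpanSingleton R _ (e x))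
        (LinearMap.toSpanSingleton R _ (Finsupp.single (UTree.unit x : UTree F.Label x x) (1 : R)))
        (D := (F.sub 0).carrier x x)
        (by rw [F.sub_zero_self, LinearMap.range_toSpanSingleton]) (by
          intro r hr
          have : r = 0 := F.unit_injective x (by simpa using hr)
          simp [this])
      refine ⟨k, fun _ h' => ?_, ?_⟩
      · have := hk 1 (by simpa using h')
        simpa only [LinearMap.toSpanSingleton_apply, one_smul] using this
      · rintro P h1 - ⟨f, hf⟩
        have hf' := hf
        rw [F.sub_zero_self, Submodule.mem_span_singleton] at hf'
        obtain ⟨r, rfl⟩ := hf'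
        have := hk r hf
        simp only [LinearMap.toSpanSingleton_apply] at this
        rw [this]
        exact h1 x r
    · refine ⟨0, fun h => absurd h hxy, ?_⟩
      rintro P - h2 ⟨f, hf⟩
      have hf' := hf
      rw [F.sub_zero_ne x y hxy, Submodule.mem_bot] at hf'
      subst hf'
      exact h2 x y
  choose σ hσ1 hσ2 using key
  have hunit : ∀ x, σ x x ⟨e x, F.unit_mem 0 x⟩ = Finsupp.single (.unit x) 1 :=
    fun x => hσ1 x x rfl _
  refine ⟨σ, hunit, ?_, ?_, ?_, ?_⟩
  · intro x y s h hs
    refine strict_of_generators (fun x y => {f | ∃ h : x = y, f.1 = h ▸ e x}) ?_ ?_ s h hs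
    · intro x y
      rw [eq_top_iff]
      rintro ⟨f, hf⟩ -
      refine hσ2 x y (fun x y f _ => ∀ hf : f ∈ (F.sub 0).carrier x y, (⟨f, hf⟩ : F.SubHom 0 x y) ∈
        Submodule.span R {f : F.SubHom 0 x y | ∃ h : x = y, f.1 = h ▸ e x}) ?_ ?_ ⟨f, hf⟩ hf
      · intro x r hf
        exact Submodule.smul_mem _ r (Submodule.subset_span
          (show (⟨e x, F.unit_mem 0 x⟩ : F.SubHom 0 x x) ∈
            {f : F.SubHom 0 x x | ∃ h : x = x, f.1 = h ▸ e x} from ⟨rfl, rfl⟩))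
      · exact fun x y hf => Submodule.zero_mem _
    · intro x y s hG h hs
      match s, hG, h, hs with
      | .cons ⟨f, hf⟩ (.cons ⟨g, hg⟩ s), hG, h, _ =>
        obtain ⟨⟨rfl, hf'⟩, ⟨rfl, hg'⟩, hG⟩ := hG
        change f = e x at hf'
        change g = e x at hg'
        subst hf' hg'
        -- Generators are now units: the binary product of two units is a unit on both sides, and
        -- longer operations vanish on both sides.
        cases s with
        | nil =>
          simp only [Str.map, he.right, hunit, UTree.op_unit_left]
        | cons f s =>
          have h1 : A.m ((Str.cons ⟨e x, hf⟩ (.cons ⟨e x, hg⟩ (.cons f s)) :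
              Str (F.SubHom 0) x y).map fun _ _ f => f.1) = 0 :=
            he.higher (.nil x) _ (by simp [Str.length, Str.map])
          have h2 := UTree.op_unit_higher (R := R) F.labelDeg (.nil x)
            ((Str.cons ⟨e x, hg⟩ (.cons f s) : Str (F.SubHom 0) x y).map fun x y f => σ x y f)
            (by simp [Str.length, Str.map])
          have h3 : (⟨_, h⟩ : F.SubHom 0 x y) = 0 := Subtype.ext h1
          rw [h3, map_zero, ← h2, ← hunit x]
          rfl
  · intro x y i f
    refine hσ2 x y (fun x y f v => f ∈ A.gr x y i →
      v ∈ Finsupp.supported R R {u | u.deg F.labelDeg = i}) ?_ ?_ f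
    · intro x r hr
      by_cases hi : (0 : ℤ) = i
      · exact Submodule.smul_mem _ _ (Finsupp.single_mem_supported R _ hi)
      -- A multiple of the unit that is homogeneous of nonzero degree is zero, and then so is its
      -- coefficient, because the discrete category embeds.
      · have h1 := A.proj_self hr
        rw [A.proj_of_mem (Submodule.smul_mem _ r (he.mem x)), if_neg hi] at h1
        have : r = 0 := F.unit_injective x (by simpa using h1.symm)
        rw [this, zero_smul]
        exact Submodule.zero_mem _
    · exact fun _ _ _ => Submodule.zero_mem _
  · intro x y f
    refine hσ2 x y (fun x y f v => F.evalLin x y v = f) ?_ ?_ f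
    · intro x r
      rw [map_smul, evalLin_single]; rfl
    · exact fun _ _ => map_zero _
  · intro x y f
    refine hσ2 x y (fun x y f v => v ∈
      Finsupp.supported R R {u | u.rank F.stage ∈ Rank.lowDegree 0}) ?_ ?_ f
    · exact fun x r => Submodule.smul_mem _ _ (Finsupp.single_mem_supported R _ (zero_mem (Rank.lowDegree 0)))
    · exact fun _ _ => Submodule.zero_mem _

/-- A strict section of `evalLin`, compatible with the filtration. -/
structure IsGlobalSection (σ : ∀ x y, A.Hom x y →ₗ[R] Lin R (UTree F.Label) x y) : Prop where
  strict : ∀ {x y : A.Ob} (s : Str A.Hom x y), 2 ≤ s.length →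
    σ x y (A.m s) = UTree.op R F.labelDeg (s.map fun x y f => σ x y f)
  eval : ∀ {x y : A.Ob} (f : A.Hom x y), F.evalLin x y (σ x y f) = f
  low : ∀ {x y : A.Ob} (n : ℕ) (f : A.Hom x y), f ∈ (F.sub n).carrier x y →
    σ x y f ∈ Finsupp.supported R R {u | u.rank F.stage ∈ Rank.lowDegree n}
  gen : ∀ {x y : A.Ob} (l : F.Label x y), σ x y (F.gen x y l) ∈
    Finsupp.supported R R {u | u.rank F.stage ≤ Rank.pow (F.stage x y l + 1)}

/-- The successive extensions agree on smaller subcategories, so they glue over the exhaustive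
filtration. -/
theorem exists_isGlobalSection (he : A.IsStrictUnit e) : ∃ σ, F.IsGlobalSection σ := by
  obtain ⟨σ₀, hσ₀⟩ := F.exists_isSection_zero he
  choose next hnext hext hgen using fun (n : ℕ) (σ : {σ // F.IsSection n σ}) =>
    σ.2.exists_extension he
  let τ : ∀ n, {σ // F.IsSection n σ} := fun n =>
    Nat.rec ⟨σ₀, hσ₀⟩ (fun n σ => ⟨next n σ, hnext n σ⟩) n
  have hτ : ∀ {n k : ℕ} (_ : n ≤ k) {x y : A.Ob} (f : A.Hom x y) (h : f ∈ (F.sub n).carrier x y)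
      (h' : f ∈ (F.sub k).carrier x y), (τ k).1 x y ⟨f, h'⟩ = (τ n).1 x y ⟨f, h⟩ := by
    intro n k hnk
    induction k, hnk using Nat.le_induction with
    | base => exact fun _ _ _ => rfl
    | succ k hk ih =>
      intro x y f h h'
      have hfk := F.sub_mono hk x y h
      exact (hext k (τ k) f hfk h').trans (ih f h hfk)
  -- `N` is an arbitrary choice of stage; `hτ'` shows that the value does not depend on it.
  choose N hN using F.exhaustive
  have hτ' : ∀ {n : ℕ} {x y : A.Ob} (f : A.Hom x y) (h : f ∈ (F.sub n).carrier x y),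
      (τ (N x y f)).1 x y ⟨f, hN x y f⟩ = (τ n).1 x y ⟨f, h⟩ := by
    intro n x y f h
    rcases le_total n (N x y f) with hn | hn
    · exact hτ hn f h _
    · exact (hτ hn f _ h).symm
  let σ : ∀ x y, A.Hom x y →ₗ[R] Lin R (UTree F.Label) x y := fun x y =>
    { toFun := fun f => (τ (N x y f)).1 x y ⟨f, hN x y f⟩
      map_add' := fun f g => by
        have hf := F.sub_mono (le_max_left (N x y f) (N x y g)) x y (hN x y f)
        have hg := F.sub_mono (le_max_right (N x y f) (N x y g)) x y (hN x y g)
        rw [hτ' f hf, hτ' g hg, hτ' (f + g) (Submodule.add_mem _ hf hg), ← map_add]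
        rfl
      map_smul' := fun r f => by
        have hf := hN x y f
        rw [hτ' (r • f) (Submodule.smul_mem _ r hf), RingHom.id_apply, ← map_smul]
        rfl }
  have hσ : ∀ {n : ℕ} {x y : A.Ob} (f : A.Hom x y) (h : f ∈ (F.sub n).carrier x y),
      σ x y f = (τ n).1 x y ⟨f, h⟩ := hτ'
  refine ⟨σ, ?_, ?_, ?_, ?_⟩
  · intro x y s hs
    -- A string has finitely many arrows, so it lies in a single stage.
    obtain ⟨n, s', rfl⟩ : ∃ (n : ℕ) (s' : Str (F.SubHom n) x y), s = s'.map fun _ _ f => f.1 := by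
      clear hs
      induction s with
      | nil x => exact ⟨0, .nil x, rfl⟩
      | @cons x y z f s ih =>
        obtain ⟨n, s', rfl⟩ := ih
        refine ⟨max n (N x y f), .cons ⟨f, F.sub_mono (le_max_right _ _) x y (hN x y f)⟩
          (s'.map fun x y f => ⟨f.1, F.sub_mono (le_max_left _ _) x y f.2⟩), ?_⟩
        simp only [Str.map, Str.map_map]
    have hm : A.m (s'.map fun _ _ f => f.1) ∈ (F.sub n).carrier x y :=
      F.sub_isSubcategory n _ (Str.all_map.2 (Str.all_of_forall (fun _ _ f => f.2) s'))
    rw [hσ _ hm, (τ n).2.strict s' hm (by rwa [Str.length_map] at hs), Str.map_map]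
    congr 1
    exact Str.map_congr (Str.all_of_forall (fun x y f => (hσ f.1 f.2).symm) s')
  · intro x y f
    rw [hσ f (hN x y f), (τ _).2.eval]
  · intro x y n f hf
    rw [hσ f hf]
    exact (τ n).2.low _
  · intro x y l
    have h : F.gen x y l ∈ (F.sub (F.stage x y l + 1)).carrier x y :=
      F.quiv_le_sub _ x y (F.compl_le_quiv _ x y (F.gen_mem_compl l))
    rw [hσ _ h]
    exact hgen _ (τ _) l rfl h

variable {F} {σ : ∀ x y, A.Hom x y →ₗ[R] Lin R (UTree F.Label) x y}

/-- Because the generators may be dependent, `σ` need not return the tree that was evaluated; what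
survives is that `σ ∘ ev` does not raise ranks. -/
theorem IsGlobalSection.rank_le (hσ : F.IsGlobalSection σ) {x y : A.Ob} (t : PTree F.Label x y) :
    σ x y (t.fold A.m F.gen) ∈
      Finsupp.supported R R {u | u.rank F.stage ≤ t.rank F.stage} := by
  refine PTree.induction (P := fun x y t => σ x y (t.fold A.m F.gen) ∈
    Finsupp.supported R R {u | u.rank F.stage ≤ t.rank F.stage}) ?_ ?_ t
  · intro x y l
    rw [PTree.fold_leaf, PTree.rank_leaf]
    exact hσ.gen l
  · intro x y z w t₁ t₂ s h₁ h₂ h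
    have hs : (Str.cons t₁ (.cons t₂ s)).All fun x y t => σ x y (t.fold A.m F.gen) ∈
      Finsupp.supported R R {u | u.rank F.stage ≤ t.rank F.stage} := ⟨h₁, h₂, h⟩
    rw [PTree.fold_node, hσ.strict _ (by simp [Str.map, Str.length]), Str.map_map,
      PTree.rank_node]
    exact UTree.op_mem_rank_le F.labelDeg F.stage
      (φ := fun x y (t : PTree F.Label x y) => σ x y (t.fold A.m F.gen)) hs

/-- These are the terms of the `A∞`-relation other than `m¹(mᵏ(…))`. Since `p` and `q` are not both
empty, the outer operation has at least two inputs and `σ` turns it into `op`. An empty `b`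
contributes zero, one of length one contributes an inner differential, and a longer one loses a unit
in the vertex count. -/
theorem IsGlobalSection.inner_term_mem (hσ : F.IsGlobalSection σ) {x y z w : A.Ob}
    (p : Str (PTree F.Label) x y) (b : Str (PTree F.Label) y z) (q : Str (PTree F.Label) z w)
    (hl : p.length + q.length ≠ 0)
    (hb : b.All fun x y t => σ x y (A.m₁ x y (t.fold A.m F.gen)) ∈
      Finsupp.supported R R {u | u.rank F.stage < t.rank F.stage}) :
    σ x w (A.m ((p.map fun _ _ t => t.fold A.m F.gen).append
      (.cons (A.m (b.map fun _ _ t => t.fold A.m F.gen)) (q.map fun _ _ t => t.fold A.m F.gen)))) ∈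
      Finsupp.supported R R {u | u.rank F.stage <
        (p.append (b.append q)).total (fun _ _ t => t.rank F.stage) +
          ((p.append (b.append q)).length - 2) • Rank.pow 0} := by
  have hle : ∀ {x y : A.Ob} (s : Str (PTree F.Label) x y), s.All fun x y t =>
      σ x y (t.fold A.m F.gen) ∈
        Finsupp.supported R R {u | u.rank F.stage ≤ t.rank F.stage} :=
    fun s => Str.all_of_forall (fun _ _ t => hσ.rank_le t) s
  have key : ∀ δ : Rank, σ y z (A.m (b.map fun _ _ t => t.fold A.m F.gen)) ∈
      Finsupp.supported R R {u | u.rank F.stage < δ} →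
      σ x w (A.m ((p.map fun _ _ t => t.fold A.m F.gen).append (.cons
        (A.m (b.map fun _ _ t => t.fold A.m F.gen)) (q.map fun _ _ t => t.fold A.m F.gen)))) ∈
      Finsupp.supported R R {u | u.rank F.stage < p.total (fun _ _ t => t.rank F.stage) +
        (δ + q.total (fun _ _ t => t.rank F.stage)) +
          (p.length + q.length - 1) • Rank.pow 0} := by
    intro δ hδ
    rw [hσ.strict _ (by simp only [Str.length_append, Str.length, Str.length_map]; omega),
      Str.map_append, Str.map_map]
    simp only [Str.map, Str.map_map]
    exact UTree.op_mem_rank_lt F.labelDeg F.stage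
      (φ := fun x y (t : PTree F.Label x y) => σ x y (t.fold A.m F.gen)) (hle p) hδ (hle q)
  simp only [Str.total_append, Str.length_append]
  match b, hb, key with
  | .nil _, _, _ =>
    rw [Str.map, A.m_nil, A.m_zero, map_zero]
    exact Submodule.zero_mem _
  | .cons t (.nil _), hb, key =>
    have h := key _ hb.1
    have e1 : p.length + ((Str.cons t (.nil _)).length + q.length) - 2 =
        p.length + q.length - 1 := by simp only [Str.length]; omega
    rw [e1]
    simpa only [Str.total, add_zero] using h
  | .cons t₁ (.cons t₂ b), hb, key =>
    set b' := Str.cons t₁ (.cons t₂ b) with hb'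
    have h2 : 2 ≤ b'.length := by simp [hb', Str.length]
    -- The bound from `op_mem_rank_le` is weak; adding `1` makes it strict. This uses exactly the
    -- `1` by which the two vertices together weigh less than the single vertex they replace.
    have h1 : σ y z (A.m (b'.map fun _ _ t => t.fold A.m F.gen)) ∈
        Finsupp.supported R R {u | u.rank F.stage <
          b'.total (fun _ _ t => t.rank F.stage) + (b'.length - 2) • Rank.pow 0 + Rank.pow 0} := by
      rw [hσ.strict _ (by rwa [Str.length_map]), Str.map_map]
      refine Finsupp.supported_mono (fun u hu => ?_) (UTree.op_mem_rank_le F.labelDeg F.stage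
        (φ := fun x y (t : PTree F.Label x y) => σ x y (t.fold A.m F.gen)) (hle b'))
      exact lt_of_le_of_lt hu (lt_add_of_pos_right _ (Rank.pow_pos 0))
    have h := key _ h1
    have e1 : p.length + (b'.length + q.length) - 2 =
        (b'.length - 2) + 1 + (p.length + q.length - 1) := by omega
    rw [e1, add_nsmul, add_nsmul, one_nsmul]
    generalize (b'.length - 2) • Rank.pow 0 = X at h ⊢
    generalize (p.length + q.length - 1) • Rank.pow 0 = Y at h ⊢
    intro v hv
    have hv' : v.rank F.stage < _ := h hv
    change v.rank F.stage < _
    refine hv'.trans_eq ?_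
    ac_rfl

/-- The differential lowers the rank. -/
theorem IsGlobalSection.m₁_rank_lt (hσ : F.IsGlobalSection σ) {x y : A.Ob}
    (t : PTree F.Label x y) : σ x y (A.m₁ x y (t.fold A.m F.gen)) ∈
      Finsupp.supported R R {u | u.rank F.stage < t.rank F.stage} := by
  refine PTree.induction (P := fun x y t => σ x y (A.m₁ x y (t.fold A.m F.gen)) ∈
    Finsupp.supported R R {u | u.rank F.stage < t.rank F.stage}) ?_ ?_ t
  · intro x y l
    rw [PTree.fold_leaf, PTree.rank_leaf]
    -- Zero differential on the quotient puts the boundary of a generator in the preceding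
    -- subcategory, hence below its power.
    have hl := hσ.low (F.stage x y l) _
      (F.differential_mem _ x y _ (F.compl_le_quiv _ x y (F.gen_mem_compl l)))
    exact fun u hu => Rank.lt_pow_of_mem_lowDegree (hl hu)
  · intro x y z w t₁ t₂ s h₁ h₂ h
    have hs : (Str.cons t₁ (.cons t₂ s)).All fun x y t =>
      σ x y (A.m₁ x y (t.fold A.m F.gen)) ∈
        Finsupp.supported R R {u | u.rank F.stage < t.rank F.stage} := ⟨h₁, h₂, h⟩
    rw [PTree.fold_node, PTree.rank_node]
    have hlen : s.length = (Str.cons t₁ (.cons t₂ s)).length - 2 := rfl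
    rw [hlen]
    generalize Str.cons t₁ (.cons t₂ s) = r at hs ⊢
    -- Pulling the rank condition back along `σ` gives a submodule of `Hom`, to which `m₁_m_mem`
    -- applies.
    set N : Submodule R (A.Hom x w) := (Finsupp.supported R R {u | u.rank F.stage <
      r.total (fun _ _ t => t.rank F.stage) + (r.length - 2) • Rank.pow 0}).comap (σ x w) with hN
    let θ : ∀ x y, PTree F.Label x y → Homog A.gr x y := fun x y t =>
      ⟨t.deg F.labelDeg, t.fold A.m F.gen, F.fold_gen_mem_gr t⟩
    have key := A.m₁_m_mem N.toAddSubgroup (r.map θ) (by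
      intro z w p b q hr hl
      obtain ⟨p', a', rfl, rfl, ha⟩ := Str.exists_of_map_eq_append θ hr
      obtain ⟨b', q', rfl, rfl, rfl⟩ := Str.exists_of_map_eq_append θ ha.symm
      simp only [Str.length_map] at hl
      simp only [Str.map_map]
      exact hσ.inner_term_mem p' b' q' hl (Str.all_append.1 (Str.all_append.1 hs).2).1)
    rw [Str.map_map] at key
    exact key

end SemiFreeFiltration
end AInfCat

-- Lifting along trivial fibrations

/-- Construction by well-founded recursion of a function whose values satisfy a condition that
only involves the earlier values. -/
theorem exists_wellFounded_choice {U Z : Type*} [Inhabited Z] {r : U → U → Prop}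
    (hr : WellFounded r) (P : U → (U → Z) → Z → Prop)
    (hloc : ∀ u g g' z, (∀ v, r v u → g v = g' v) → P u g z → P u g' z)
    (hex : ∀ u g, (∀ v, r v u → P v g (g v)) → ∃ z, P u g z) :
    ∃ g : U → Z, ∀ u, P u g (g u) := by
  classical
  -- The default outside the predecessors of `u` is harmless, because by `hloc` the condition at `u`
  -- does not see those values.
  let ext : ∀ u, (∀ v, r v u → Z) → U → Z := fun u prev v =>
    if h : r v u then prev v h else default
  let step : ∀ u, (∀ v, r v u → Z) → Z := fun u prev =>
    if h : ∃ z, P u (ext u prev) z then h.choose else default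
  let g : U → Z := hr.fix step
  refine ⟨g, fun u => hr.induction (C := fun u => P u g (g u)) u fun u ih => ?_⟩
  have hg : ∀ v, r v u → ext u (fun v _ => g v) v = g v := fun v hv => dif_pos hv
  obtain ⟨z, hz⟩ := hex u g ih
  have h : ∃ z, P u (ext u fun v _ => g v) z := ⟨z, hloc _ _ _ _ (fun v hv => (hg v hv).symm) hz⟩
  have hgu : g u = h.choose := by
    change hr.fix step u = _
    rw [hr.fix_eq]
    exact dif_pos h
  rw [hgu]
  exact hloc _ _ _ _ hg h.choose_spec

/-- In a degreewise surjective quasi-isomorphism, an element of the target can be lifted with a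
prescribed boundary. -/
theorem trivialFibrations.exists_lift {R : Type u} [CommRing R]
    {X Y : CochainComplex (ModuleCat.{u} R) ℤ} {p : X ⟶ Y} (hp : trivialFibrations R p) (i : ℤ)
    (y : Y.X i) (b : X.X (i + 1)) (hb : (X.d (i + 1) (i + 1 + 1)).hom b = 0)
    (hby : (p.f (i + 1)).hom b = (Y.d i (i + 1)).hom y) :
    ∃ z : X.X i, (p.f i).hom z = y ∧ (X.d i (i + 1)).hom z = b := by
  obtain ⟨hsurj, hq⟩ := hp
  have hepi : Epi p := HomologicalComplex.epi_of_epi_f _ fun i =>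
    (ModuleCat.epi_iff_surjective _).2 (hsurj i)
  let S : ShortComplex (CochainComplex (ModuleCat.{u} R) ℤ) :=
    ShortComplex.mk (Limits.kernel.ι p) p (Limits.kernel.condition p)
  have hS : S.ShortExact :=
    { exact := ShortComplex.exact_of_f_is_kernel _ (Limits.kernelIsKernel p)
      mono_f := inferInstanceAs (Mono (Limits.kernel.ι p))
      epi_g := hepi }
  -- A surjective quasi-isomorphism has an acyclic kernel.
  have hac := hS.acyclic_X₁ hq (i + 1)
  rw [HomologicalComplex.exactAt_iff' _ i (i + 1) (i + 1 + 1) (by simp) (by simp),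
    ShortComplex.moduleCat_exact_iff] at hac
  have hSi : ∀ i, (S.map (HomologicalComplex.eval _ _ i)).ShortExact :=
    fun i => hS.map_of_exact _
  have hcomm : ∀ {U V : CochainComplex (ModuleCat.{u} R) ℤ} (f : U ⟶ V) (i j : ℤ) (z : U.X i),
      (V.d i j).hom ((f.f i).hom z) = (f.f j).hom ((U.d i j).hom z) := fun f i j z =>
    LinearMap.congr_fun (congrArg ModuleCat.Hom.hom (f.comm i j)) z
  have hdd : ∀ (U : CochainComplex (ModuleCat.{u} R) ℤ) (i j k : ℤ) (z : U.X i),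
      (U.d j k).hom ((U.d i j).hom z) = 0 := fun U i j k z =>
    LinearMap.congr_fun (congrArg ModuleCat.Hom.hom (U.d_comp_d i j k)) z
  -- An arbitrary lift `z₀` has boundary differing from `b` by a cycle of the kernel; subtracting a
  -- primitive of that cycle corrects the boundary without changing the image.
  obtain ⟨z₀, hz₀⟩ := hsurj i y
  change (p.f i).hom z₀ = y at hz₀
  obtain ⟨k, hk⟩ : ∃ k : (Limits.kernel p).X (i + 1), ((Limits.kernel.ι p).f (i + 1)).hom k =
      (X.d i (i + 1)).hom z₀ - b := (ShortComplex.moduleCat_exact_iff _).1 (hSi (i + 1)).exact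
    ((X.d i (i + 1)).hom z₀ - b) (by
      change (p.f (i + 1)).hom _ = 0
      rw [map_sub, ← hcomm, hz₀, hby, sub_self])
  have hdk : ((Limits.kernel p).d (i + 1) (i + 1 + 1)).hom k = 0 := by
    apply (hSi (i + 1 + 1)).moduleCat_injective_f
    change ((Limits.kernel.ι p).f (i + 1 + 1)).hom _ = ((Limits.kernel.ι p).f (i + 1 + 1)).hom 0
    rw [← hcomm, hk, map_sub, hdd, hb, sub_zero, map_zero]
  obtain ⟨k', hk'⟩ : ∃ k' : (Limits.kernel p).X i,
      ((Limits.kernel p).d i (i + 1)).hom k' = k := hac k hdk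
  refine ⟨z₀ - ((Limits.kernel.ι p).f i).hom k', ?_, ?_⟩
  · have : (p.f i).hom (((Limits.kernel.ι p).f i).hom k') = 0 :=
      LinearMap.congr_fun (congrArg ModuleCat.Hom.hom
        (HomologicalComplex.congr_hom (Limits.kernel.condition p) i)) k'
    rw [map_sub, hz₀, this, sub_zero]
  · rw [map_sub, hcomm, hk', hk, sub_sub_cancel]

namespace AInfCat
namespace SemiFreeFiltration

variable {R : Type u} [CommRing R] {A : AInfCat R} {e : ∀ x, A.Hom x x}
  {F : A.SemiFreeFiltration e} {σ : ∀ x y, A.Hom x y →ₗ[R] Lin R (UTree F.Label) x y}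

/-- The value of a basis element is homogeneous, so its projection is either itself or zero. Units
are closed. -/
theorem IsGlobalSection.proj_rank_lt (he : A.IsStrictUnit e) (hσ : F.IsGlobalSection σ)
    {x y : A.Ob} (i : ℤ) (u : UTree F.Label x y) :
    σ x y (A.m₁ x y (A.proj x y i (F.evalBasis u))) ∈
      Finsupp.supported R R {v | v.rank F.stage < u.rank F.stage} := by
  rw [A.proj_of_mem (F.evalBasis_mem_gr he u)]
  split_ifs
  · cases u with
    | unit =>
      change σ x x (A.m₁ x x (e x)) ∈ _
      rw [he.closed, map_zero]
      exact Submodule.zero_mem _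
    | tree t => exact hσ.m₁_rank_lt t
  · rw [map_zero, map_zero]
    exact Submodule.zero_mem _

/-- The values of the lift on the basis of `U` are chosen by recursion on rank, and the result is
pulled back to `Hom` along `σ`. Working with all of `Hom` and projecting to degree `i` avoids
splitting `U` by degree. -/
theorem IsGlobalSection.exists_lift (he : A.IsStrictUnit e) (hσ : F.IsGlobalSection σ)
    {x y : A.Ob} {X Y : CochainComplex (ModuleCat.{u} R) ℤ} {p : X ⟶ Y}
    (hp : trivialFibrations R p) (φ : ∀ i, A.Hom x y →ₗ[R] Y.X i)
    (hφ : ∀ i g, g ∈ A.gr x y i → φ (i + 1) (A.m₁ x y g) = (Y.d i (i + 1)).hom (φ i g)) :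
    ∃ l : ∀ i, A.Hom x y →ₗ[R] X.X i, ∀ i g, g ∈ A.gr x y i →
      (p.f i).hom (l i g) = φ i g ∧ (X.d i (i + 1)).hom (l i g) = l (i + 1) (A.m₁ x y g) := by
  let Ξ : (UTree F.Label x y → ∀ i, X.X i) → ∀ i, Lin R (UTree F.Label) x y →ₗ[R] X.X i :=
    fun g i => Finsupp.linearCombination R fun u => g u i
  -- The value at `u` must lift `φ` and have as boundary the value already assigned to `σ (m¹ (ev
  -- u))`, which is supported in smaller rank.
  let P : UTree F.Label x y → (UTree F.Label x y → ∀ i, X.X i) → (∀ i, X.X i) → Prop :=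
    fun u g z => ∀ i, (p.f i).hom (z i) = φ i (A.proj x y i (F.evalBasis u)) ∧
      (X.d i (i + 1)).hom (z i) = Ξ g (i + 1) (σ x y (A.m₁ x y (A.proj x y i (F.evalBasis u))))
  -- Both conditions in `P` are linear, so they pass from basis elements to combinations. This
  -- serves the recursion step on boundaries and also the final conclusion.
  have main : ∀ (g : UTree F.Label x y → ∀ i, X.X i) (c : Lin R (UTree F.Label) x y),
      (∀ u ∈ c.support, P u g (g u)) → ∀ i,
      (p.f i).hom (Ξ g i c) = φ i (A.proj x y i (F.evalLin x y c)) ∧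
      (X.d i (i + 1)).hom (Ξ g i c) =
        Ξ g (i + 1) (σ x y (A.m₁ x y (A.proj x y i (F.evalLin x y c)))) := by
    intro g c hc i
    simp only [Ξ, evalLin]
    rw [Finsupp.linearCombination_apply, Finsupp.linearCombination_apply, Finsupp.sum, Finsupp.sum]
    simp only [map_sum, map_smul]
    exact ⟨Finset.sum_congr rfl fun u hu => by rw [(hc u hu i).1],
      Finset.sum_congr rfl fun u hu => by rw [(hc u hu i).2]⟩
  have hm : ∀ i (g : A.Hom x y), A.m₁ x y (A.proj x y i g) ∈ A.gr x y (i + 1) :=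
    fun i g => A.m₁_mem (A.proj_mem i g)
  have : Inhabited (∀ i, X.X i) := ⟨fun _ => 0⟩
  obtain ⟨g, hg⟩ := exists_wellFounded_choice
    (r := fun u v : UTree F.Label x y => u.rank F.stage < v.rank F.stage)
    (InvImage.wf _ wellFounded_lt) P (by
      intro u g g' z hgg' hz i
      refine ⟨(hz i).1, (hz i).2.trans ?_⟩
      simp only [Ξ]
      rw [Finsupp.linearCombination_apply, Finsupp.linearCombination_apply]
      refine Finset.sum_congr rfl fun v hv => ?_
      dsimp only
      rw [hgg' v (hσ.proj_rank_lt he i u hv)]) (by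
      intro u g hg
      have key : ∀ i, ∃ z : X.X i, (p.f i).hom z = φ i (A.proj x y i (F.evalBasis u)) ∧
          (X.d i (i + 1)).hom z =
            Ξ g (i + 1) (σ x y (A.m₁ x y (A.proj x y i (F.evalBasis u)))) := by
        intro i
        obtain ⟨h1, h2⟩ := main g (σ x y (A.m₁ x y (A.proj x y i (F.evalBasis u))))
          (fun v hv => hg v (hσ.proj_rank_lt he i u hv)) (i + 1)
        -- By `ev ∘ σ = 1`, `main` now speaks of the boundary itself: it gives that the prescribed
        -- boundary is closed, from `m¹ m¹ = 0`, and that its image is the boundary of the target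
        -- element.
        rw [hσ.eval, A.proj_self (hm i _)] at h1 h2
        refine hp.exists_lift i _ _ ?_ ?_
        · rw [A.m₁_m₁ (A.proj_mem i _), map_zero, map_zero] at h2
          exact h2
        · rw [h1, hφ i _ (A.proj_mem i _)]
      choose z hz using key
      exact ⟨z, hz⟩)
  refine ⟨fun i => Ξ g i ∘ₗ σ x y, fun i a ha => ?_⟩
  have := main g (σ x y a) (fun u _ => hg u) i
  rw [hσ.eval, A.proj_self ha] at this
  exact this

end SemiFreeFiltration

theorem homComplex_d {R : Type u} [CommRing R] (A : AInfCat R) (x y : A.Ob) (i : ℤ) :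
    (A.homComplex x y).d i (i + 1) = ModuleCat.ofHom ((A.m₁ x y).restrict
      (p := A.gr x y i) (q := A.gr x y (i + 1)) fun _ hf => A.m₁_mem hf) := by
  unfold homComplex
  exact CochainComplex.of_d (fun i => ModuleCat.of R (A.gr x y i)) (fun i =>
    ModuleCat.ofHom ((A.m₁ x y).restrict (p := A.gr x y i) (q := A.gr x y (i + 1))
      fun _ hf => A.m₁_mem hf)) i

/-- The chain maps from `homComplex`, on elements. -/
theorem homComplex_comm {R : Type u} [CommRing R] {A : AInfCat R} {x y : A.Ob}
    {Y : CochainComplex (ModuleCat.{u} R) ℤ} (f : A.homComplex x y ⟶ Y) (i : ℤ)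
    (g : A.gr x y i) : (f.f (i + 1)).hom ⟨A.m₁ x y g, A.m₁_mem g.2⟩ =
      (Y.d i (i + 1)).hom ((f.f i).hom g) := by
  have h := LinearMap.congr_fun (congrArg ModuleCat.Hom.hom (f.comm i (i + 1))) g
  rw [homComplex_d] at h
  exact h.symm

theorem IsSemiFree.hasCofibrantMorphisms {R : Type u} [CommRing R] {A : AInfCat R}
    (hA : A.IsSemiFree) : A.HasCofibrantMorphisms := by
  obtain ⟨e, he, ⟨F⟩⟩ := hA
  obtain ⟨σ, hσ⟩ := F.exists_isGlobalSection he
  intro x y X Y p hp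
  refine ⟨fun {f g} sq => ?_⟩
  -- `exists_lift` takes maps defined on the whole hom-space, so the components of `g` are extended
  -- by projection.
  let pr : ∀ i, A.Hom x y →ₗ[R] A.gr x y i := fun i =>
    (A.proj x y i).codRestrict _ fun f => A.proj_mem i f
  have hpr : ∀ i (a : A.gr x y i), pr i a = a := fun i a => Subtype.ext (A.proj_self a.2)
  obtain ⟨l, hl⟩ := hσ.exists_lift he hp (x := x) (y := y) (fun i => (g.f i).hom ∘ₗ pr i) (by
    intro i a ha
    have h := homComplex_comm g i ⟨a, ha⟩
    have h1 : pr i a = ⟨a, ha⟩ := hpr i ⟨a, ha⟩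
    have h2 : pr (i + 1) (A.m₁ x y a) = ⟨A.m₁ x y a, A.m₁_mem ha⟩ := hpr (i + 1) ⟨_, A.m₁_mem ha⟩
    exact (congrArg (g.f (i + 1)).hom h2).trans
      (h.trans (congrArg (fun z => (Y.d i (i + 1)).hom ((g.f i).hom z)) h1.symm)))
  let L : A.homComplex x y ⟶ X :=
    { f := fun i => ModuleCat.ofHom (l i ∘ₗ (A.gr x y i).subtype)
      comm' := by
        rintro i _ rfl
        rw [homComplex_d]
        ext a
        exact (hl i a.1 a.2).2 }
  refine ⟨⟨⟨L, Limits.initialIsInitial.hom_ext _ _, ?_⟩⟩⟩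
  ext i a
  exact (hl i a.1 a.2).1.trans (congrArg (g.f i).hom (hpr i a))

end AInfCat

end AInf

end

theorem mainTheorem3 {R : Type u} [CommRing R] (A : AInf.AInfCat R) (hA : A.IsSemiFree) :
    A.HasCofibrantMorphisms :=
  hA.hasCofibrantMorphisms
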